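/- Let $F$ be a free group of finite rank with free basis $\mathcal B$, let $\mathcal T$ be its Cayley graph (a tree), and let $\partial_\infty F$ be its boundary (infinite reduced words, i.e. geodesic rays of $\mathcal T$ from the identity $e$). Let $W\subset F$ be a finite set of words, $\mathcal L=\{\{gw^k\}_{k\in\mathbb Z} : g\in F, w\in W\}$ the associated line pattern, and $\mathcal D$ the decomposition space: the quotient, with quotient map $q$, of $\partial_\infty F$ that identifies the two end points of each line in $\mathcal L$ (for $w=1$ there are no end points). For an open cover $\mathcal U=(U_i)_{i\in I}$ of $\mathcal D$ let $\check H^n(\mathcal U,\mathbb Z)$ be the cohomology of the complex of alternating integer cochains on the nerve of $\mathcal U$, and let $\check H^n(\mathcal D,\mathbb Z)$ be the direct limit of these groups over all open covers, preordered by refinement. Let $\mathcal X$ be a finite subtree of $\mathcal T$. The Whitehead graph $\mathrm{Wh}(\mathcal X)$ has as vertices the vertices $a\notin\mathcal X$ of $\mathcal T$ adjacent to $\mathcal X$; the shadow $S(a)$ is the set of $\xi\in\partial_\infty F$ such that the geodesic rays from points of $\mathcal X$ to $\xi$ contain $a$; distinct $a,b$ are joined by an edge iff some line in $\mathcal L$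 has one end point in $S(a)$ and one in $S(b)$. For the empty subtree the Whitehead graph is by convention a single vertex with shadow $\partial_\infty F$. A cover associated to $\mathcal X$ is an open cover $\mathcal U_{\mathcal X}=(U_a)$ of $\mathcal D$, indexed by the vertices $a$ of $\mathrm{Wh}(\mathcal X)$, such that $q(S(a))\subset U_a$; for $a\ne b$, $U_a\cap U_b\neq\emptyset$ iff $a$ and $b$ are joined by an edge of $\mathrm{Wh}(\mathcal X)$; and $U_a\cap U_b\cap U_c=\emptyset$ for distinct $a,b,c$. Then: 1. The finite subtrees are directed under inclusion. Every finite subtree has an associated cover, and one can choose covers $\mathcal U_{\mathcal X}$ for all $\mathcal X$ such that $\mathcal U_{\mathcal X'}$ refines $\mathcal U_{\mathcal X}$ whenever $\mathcal X\subset\mathcal X'$. Moreover, if $\mathcal X\subset\mathcal X'$, every cover associated to $\mathcal X$ is refined by one associated to $\mathcal X'$. 2. Every open cover of $\mathcal D$ is refined by a cover associated to some finite subtree. 3. For nonempty $\mathcal X$ the nerve of any associated cover is $\mathrm{Wh}(\mathcal X)$: finitely many members of the cover have a common point iff their indices all lie in a single vertex or a single edge of $\mathrm{Wh}(\mathcal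 X)$. 4. For every choice of covers $\mathcal U_{\mathcal X}$ such that $\mathcal U_{\mathcal X'}$ refines $\mathcal U_{\mathcal X}$ whenever $\mathcal X\subset\mathcal X'$, and every $n\ge 0$, the groups $\check H^n(\mathcal U_{\mathcal X},\mathbb Z)$ form a directed system, with transition maps that do not depend on the choice of refinement functions, and the canonical map $$\varinjlim_{\mathcal X}\check H^n(\mathcal U_{\mathcal X},\mathbb Z)\longrightarrow\check H^n(\mathcal D,\mathbb Z)$$ over finite subtrees $\mathcal X$ ordered by inclusion is an isomorphism. 5. For $n\ge2$, $\check H^n(\mathcal U_{\mathcal X},\mathbb Z)=0$ for every associated cover, and $\check H^n(\mathcal D,\mathbb Z)=0$. -/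

import Mathlib

open TopologicalSpace

universe u

noncomputable section

/-! ### Čech cohomology with integer coefficients -/

namespace Cech

/-- An open cover of `Y`: an indexed family of open sets whose union is `Y`. -/
structure OpenCover (Y : Type u) [TopologicalSpace Y] : Type (u + 1) where
  ι : Type u
  U : ι → Opens Y
  isOpenCover : IsOpenCover U

variable {Y : Type u} [TopologicalSpace Y]

/-- `ρ` is a refinement function exhibiting `𝒱` as a refinement of `𝒰`. -/
def IsRefinement (𝒰 𝒱 : OpenCover Y) (ρ : 𝒱.ι → 𝒰.ι) : Prop :=
  ∀ j, 𝒱.U j ≤ 𝒰.U (ρ j)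

/-- Open covers are preordered by refinement: `𝒰 ≤ 𝒱` iff `𝒱` refines `𝒰`. -/
instance : Preorder (OpenCover Y) where
  le 𝒰 𝒱 := ∃ ρ : 𝒱.ι → 𝒰.ι, IsRefinement 𝒰 𝒱 ρ
  le_refl _ := ⟨id, fun _ => le_rfl⟩
  le_trans _ _ _ := fun ⟨ρ, hρ⟩ ⟨σ, hσ⟩ => ⟨ρ ∘ σ, fun k => (hσ k).trans (hρ (σ k))⟩

/-- The tuple `t` of members of the cover has a common point. -/
def Meets (𝒰 : OpenCover Y) {n : ℕ} (t : Fin (n + 1) → 𝒰.ι) : Prop :=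
  (⋂ i, (𝒰.U (t i) : Set Y)).Nonempty

/-- The ordered `n`-simplices (possibly degenerate) of the nerve of a cover. -/
def Simplex (𝒰 : OpenCover Y) (n : ℕ) : Type u :=
  {t : Fin (n + 1) → 𝒰.ι // Meets 𝒰 t}

/-- Reindexing of simplices: faces, degeneracies and permutations of the vertices. -/
def Simplex.reindex {𝒰 : OpenCover Y} {n m : ℕ} (t : Simplex 𝒰 n)
    (φ : Fin (m + 1) → Fin (n + 1)) : Simplex 𝒰 m :=
  ⟨t.1 ∘ φ, by
    obtain ⟨y, hy⟩ := t.2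
    exact ⟨y, Set.mem_iInter.2 fun i => Set.mem_iInter.1 hy (φ i)⟩⟩

/-- The image of a simplex under the map of nerves given by a refinement function. -/
def Simplex.map {𝒰 𝒱 : OpenCover Y} {ρ : 𝒱.ι → 𝒰.ι} (hρ : IsRefinement 𝒰 𝒱 ρ) {n : ℕ}
    (t : Simplex 𝒱 n) : Simplex 𝒰 n :=
  ⟨ρ ∘ t.1, by
    obtain ⟨y, hy⟩ := t.2
    exact ⟨y, Set.mem_iInter.2 fun i => hρ _ (Set.mem_iInter.1 hy i)⟩⟩

/-- The group of (alternating) Čech `n`-cochains of a cover with integer coefficients: the integer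
functions on the ordered `n`-simplices of the nerve that change by the sign under permutations of
the vertices. As `ℤ` has no `2`-torsion, they vanish on degenerate simplices. -/
def Cochain (𝒰 : OpenCover Y) (n : ℕ) : Submodule ℤ (Simplex 𝒰 n → ℤ) where
  carrier := {f | ∀ (t : Simplex 𝒰 n) (σ : Equiv.Perm (Fin (n + 1))),
    f (t.reindex σ) = (Equiv.Perm.sign σ : ℤ) * f t}
  add_mem' {f g} hf hg t σ := by
    simp only [Pi.add_apply, hf t σ, hg t σ, mul_add]
  zero_mem' t σ := by simp
  smul_mem' c f hf t σ := by
    simp only [Pi.smul_apply, hf t σ, smul_eq_mul]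
    ring

theorem exists_perm_succAbove {n : ℕ} (σ : Equiv.Perm (Fin (n + 2))) (k : Fin (n + 2)) :
    ∃ τ : Equiv.Perm (Fin (n + 1)), (∀ j, σ (k.succAbove j) = (σ k).succAbove (τ j)) ∧
      (-1 : ℤ) ^ (k : ℕ) * (Equiv.Perm.sign τ : ℤ) =
        (Equiv.Perm.sign σ : ℤ) * (-1) ^ (σ k : ℕ) := by
  set r : Equiv.Perm (Fin (n + 2)) := (σ k).cycleRange * σ * k.cycleRange.symm with hr
  have h0 : r 0 = 0 := by simp [hr, Equiv.Perm.mul_apply]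
  obtain ⟨⟨p, τ⟩, hpτ⟩ := (Equiv.Perm.decomposeFin (n := n + 1)).symm.surjective r
  have hp : p = 0 := by
    have := congrArg (fun e : Equiv.Perm (Fin (n + 2)) => e 0) hpτ
    simpa [h0] using this
  subst hp
  have hτ : ∀ j, r j.succ = (τ j).succ := by
    intro j
    rw [← hpτ]
    simp
  refine ⟨τ, fun j => ?_, ?_⟩
  · have h1 := hτ j
    simp only [hr, Equiv.Perm.mul_apply, Fin.cycleRange_symm_succ] at h1
    rw [← (σ k).cycleRange_symm_succ, ← h1, Equiv.symm_apply_apply]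
  · have hs : Equiv.Perm.sign r = Equiv.Perm.sign τ := by
      rw [← hpτ]
      simp
    have hs2 : Equiv.Perm.sign r = (-1) ^ (σ k : ℕ) * Equiv.Perm.sign σ * (-1) ^ (k : ℕ) := by
      simp [hr, Equiv.Perm.sign_mul, Fin.sign_cycleRange]
    rw [← hs, hs2]
    push_cast
    have hk : ((-1 : ℤ) ^ (k : ℕ)) * (-1) ^ (k : ℕ) = 1 := by
      rw [← mul_pow]; simp
    linear_combination ((Equiv.Perm.sign σ : ℤ) * (-1) ^ (σ k : ℕ)) * hk

/-- The Čech differential `(d f)(t) = ∑ₖ (-1)ᵏ f (t₀, …, t̂ₖ, …, tₙ₊₁)`. -/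
def d (𝒰 : OpenCover Y) (n : ℕ) : Cochain 𝒰 n →ₗ[ℤ] Cochain 𝒰 (n + 1) where
  toFun f := ⟨fun t => ∑ k : Fin (n + 2), (-1 : ℤ) ^ (k : ℕ) * f.1 (t.reindex k.succAbove), by
    intro t σ
    beta_reduce
    rw [← Equiv.sum_comp σ (fun k => (-1 : ℤ) ^ (k : ℕ) * f.1 (t.reindex k.succAbove)),
      Finset.mul_sum]
    refine Finset.sum_congr rfl fun k _ => ?_
    obtain ⟨τ, hτ, hs⟩ := exists_perm_succAbove σ k
    have h1 : (t.reindex σ).reindex k.succAbove = (t.reindex (σ k).succAbove).reindex τ :=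
      Subtype.ext (funext fun j => congrArg t.1 (hτ j))
    rw [h1, f.2, ← mul_assoc, hs, mul_assoc]⟩
  map_add' f g := by
    ext t
    simp [mul_add, Finset.sum_add_distrib]
  map_smul' c f := by
    ext t
    simp [Finset.mul_sum, mul_left_comm]

/-- Čech `n`-cocycles. -/
abbrev Cocycle (𝒰 : OpenCover Y) (n : ℕ) : Submodule ℤ (Cochain 𝒰 n) :=
  LinearMap.ker (d 𝒰 n)

/-- Čech `n`-coboundaries. -/
def Coboundary (𝒰 : OpenCover Y) : (n : ℕ) → Submodule ℤ (Cochain 𝒰 n)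
  | 0 => ⊥
  | n + 1 => LinearMap.range (d 𝒰 n)

/-- The `n`-th Čech cohomology group `Ȟⁿ(𝒰, ℤ)` of an open cover. -/
def CoverCohomology (𝒰 : OpenCover Y) (n : ℕ) : Type u :=
  Cocycle 𝒰 n ⧸ (Coboundary 𝒰 n).submoduleOf (Cocycle 𝒰 n)

instance (𝒰 : OpenCover Y) (n : ℕ) : AddCommGroup (CoverCohomology 𝒰 n) :=
  inferInstanceAs (AddCommGroup (Cocycle 𝒰 n ⧸ (Coboundary 𝒰 n).submoduleOf (Cocycle 𝒰 n)))

/-- The map on cochains induced by a refinement function. -/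
def pullback {𝒰 𝒱 : OpenCover Y} {ρ : 𝒱.ι → 𝒰.ι} (hρ : IsRefinement 𝒰 𝒱 ρ) (n : ℕ) :
    Cochain 𝒰 n →ₗ[ℤ] Cochain 𝒱 n where
  toFun f := ⟨fun t => f.1 (t.map hρ), fun t σ => f.2 (t.map hρ) σ⟩
  map_add' _ _ := rfl
  map_smul' _ _ := rfl

theorem d_pullback {𝒰 𝒱 : OpenCover Y} {ρ : 𝒱.ι → 𝒰.ι} (hρ : IsRefinement 𝒰 𝒱 ρ) (n : ℕ)
    (f : Cochain 𝒰 n) : d 𝒱 n (pullback hρ n f) = pullback hρ (n + 1) (d 𝒰 n f) := rfl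

/-- The map on cocycles induced by a refinement function. -/
def pullbackCocycle {𝒰 𝒱 : OpenCover Y} {ρ : 𝒱.ι → 𝒰.ι} (hρ : IsRefinement 𝒰 𝒱 ρ) (n : ℕ) :
    Cocycle 𝒰 n →ₗ[ℤ] Cocycle 𝒱 n :=
  (pullback hρ n).restrict fun f hf => by
    rw [LinearMap.mem_ker] at hf ⊢
    rw [d_pullback, hf, map_zero]

/-- The map on cohomology induced by a refinement function. -/
def refineMap {𝒰 𝒱 : OpenCover Y} {ρ : 𝒱.ι → 𝒰.ι} (hρ : IsRefinement 𝒰 𝒱 ρ) (n : ℕ) :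
    CoverCohomology 𝒰 n →ₗ[ℤ] CoverCohomology 𝒱 n :=
  Submodule.mapQ _ _ (pullbackCocycle hρ n) <| by
    rintro ⟨f, hf⟩ hfB
    change f ∈ Coboundary 𝒰 n at hfB
    change pullback hρ n f ∈ Coboundary 𝒱 n
    cases n with
    | zero =>
      have h0 : f = 0 := hfB
      rw [h0, map_zero]
      exact Submodule.zero_mem _
    | succ n =>
      obtain ⟨g, rfl⟩ := hfB
      exact ⟨pullback hρ n g, d_pullback hρ n g⟩

/-- The map `Ȟⁿ(𝒰, ℤ) → Ȟⁿ(𝒱, ℤ)` for a cover `𝒱` that refines `𝒰`, computed with any refinement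
function (different refinement functions induce the same map on cohomology). -/
def transition (n : ℕ) (𝒰 𝒱 : OpenCover Y) (h : 𝒰 ≤ 𝒱) :
    CoverCohomology 𝒰 n →ₗ[ℤ] CoverCohomology 𝒱 n :=
  refineMap h.choose_spec n

open Classical in
/-- The `n`-th Čech cohomology group `Ȟⁿ(Y, ℤ)`: the direct limit of `Ȟⁿ(𝒰, ℤ)` over all open
covers `𝒰` of `Y`, preordered by refinement. -/
abbrev Cohomology (Y : Type u) [TopologicalSpace Y] (n : ℕ) : Type (u + 1) :=
  Module.DirectLimit (fun 𝒰 : OpenCover Y => CoverCohomology 𝒰 n) (transition n)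

open Classical in
/-- The canonical map `Ȟⁿ(𝒰, ℤ) → Ȟⁿ(Y, ℤ)`. -/
def toCohomology (n : ℕ) (𝒰 : OpenCover Y) : CoverCohomology 𝒰 n →ₗ[ℤ] Cohomology Y n :=
  Module.DirectLimit.of ℤ (OpenCover Y) (fun 𝒰 : OpenCover Y => CoverCohomology 𝒰 n)
    (transition n) 𝒰

section System

variable {I : Type u} [Preorder I] (𝒰 : I → OpenCover Y) (h𝒰 : Monotone 𝒰) (n : ℕ)

open Classical in
/-- The direct limit of the groups `Ȟⁿ(𝒰 X, ℤ)` over a family of open covers such that `𝒰 X'`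
refines `𝒰 X` whenever `X ≤ X'`. -/
abbrev SystemLimit : Type u :=
  Module.DirectLimit (fun X => CoverCohomology (𝒰 X) n)
    (fun X X' h => transition n (𝒰 X) (𝒰 X') (h𝒰 h))

open Classical in
/-- The map from the direct limit over a family of open covers to `Ȟⁿ(Y, ℤ)` that is induced by
the canonical maps `Ȟⁿ(𝒰 X, ℤ) → Ȟⁿ(Y, ℤ)`. -/
def systemLimitToCohomology : SystemLimit 𝒰 h𝒰 n →ₗ[ℤ] Cohomology Y n :=
  Module.DirectLimit.lift ℤ I (fun X => CoverCohomology (𝒰 X) n)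
    (fun X X' h => transition n (𝒰 X) (𝒰 X') (h𝒰 h)) (fun X => toCohomology n (𝒰 X))
    (fun _ _ h x => Module.DirectLimit.of_f (f := transition n) (hij := h𝒰 h) (x := x))

end System

end Cech

/-! ### The decomposition space of a line pattern -/

namespace LinePattern

open Cech

variable {α : Type u}

/-- The Cayley graph `𝒯` of the free group with respect to its free basis. -/
abbrev cayleyTree (α : Type u) : SimpleGraph (FreeGroup α) :=
  SimpleGraph.mulCayley (Set.range FreeGroup.of)

/-- The vertex `v` lies on the geodesic segment `[x, y]` of `𝒯`. -/
def OnSegment (x y v : FreeGroup α) : Prop :=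
  (cayleyTree α).dist x v + (cayleyTree α).dist v y = (cayleyTree α).dist x y

/-- The boundary at infinity of the free group (equivalently of `𝒯`): infinite reduced words. -/
def Boundary (α : Type u) : Type u :=
  {ξ : ℕ → α × Bool // ∀ n, (ξ n).1 = (ξ (n + 1)).1 → (ξ n).2 = (ξ (n + 1)).2}

/-- The topology of the boundary: the subspace topology of the product of discrete spaces. -/
instance : TopologicalSpace (Boundary α) :=
  TopologicalSpace.induced Subtype.val
    (@Pi.topologicalSpace ℕ (fun _ => α × Bool) (fun _ => ⊥))

/-- The `n`-th vertex of the geodesic ray of `𝒯` from the identity to `ξ`. -/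
def Boundary.vertex (ξ : Boundary α) (n : ℕ) : FreeGroup α :=
  FreeGroup.mk (List.ofFn fun i : Fin n => ξ.1 i)

/-- The vertex `v` lies on the geodesic ray `[x, ξ)` of `𝒯`. -/
def OnRay (x : FreeGroup α) (ξ : Boundary α) (v : FreeGroup α) : Prop :=
  ∀ᶠ n in Filter.atTop, OnSegment x (ξ.vertex n) v

/-- The line pattern of a set `W` of words: the set of all lines `{g wᵏ | k ∈ ℤ}`, `w ∈ W`. -/
def lines (W : Set (FreeGroup α)) : Set (Set (FreeGroup α)) :=
  {l | ∃ w ∈ W, ∃ g : FreeGroup α, l = Set.range fun k : ℤ => g * w ^ k}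

/-- `ξ` is an end point of `l`: elements of `l` accumulate at `ξ`, that is, every vertex of the ray
`[e, ξ)` lies on a geodesic segment from `e` to an element of `l`. The line `{g wᵏ}` has two end
points if `w ≠ 1`, and none if `w = 1`. -/
def IsEndOf (ξ : Boundary α) (l : Set (FreeGroup α)) : Prop :=
  ∀ n, ∃ x ∈ l, OnSegment 1 x (ξ.vertex n)

/-- `ξ` and `η` are end points of a common line of the pattern. -/
def SameLine (W : Set (FreeGroup α)) (ξ η : Boundary α) : Prop :=
  ∃ l ∈ lines W, IsEndOf ξ l ∧ IsEndOf η l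

/-- The decomposition space `𝒟` of the line pattern: the quotient of the boundary, with the
quotient topology, that identifies the two end points of each line. -/
def DecompositionSpace (W : Set (FreeGroup α)) : Type u :=
  Quot (SameLine W)

instance (W : Set (FreeGroup α)) : TopologicalSpace (DecompositionSpace W) :=
  inferInstanceAs (TopologicalSpace (Quot (SameLine W)))

/-- The quotient map `q`. -/
def proj (W : Set (FreeGroup α)) : Boundary α → DecompositionSpace W :=
  Quot.mk (SameLine W)

/-- The finite subtrees of `𝒯`, given by their vertex sets; the empty subtree is included. -/
def FiniteSubtree (α : Type u) : Type u :=
  {X : Finset (FreeGroup α) // ((cayleyTree α).induce (X : Set (FreeGroup α))).Preconnected}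

/-- Subtrees are ordered by inclusion. -/
instance : PartialOrder (FiniteSubtree α) :=
  PartialOrder.lift Subtype.val Subtype.val_injective

/-- The vertices of the Whitehead graph at `X`: the vertices of `𝒯` outside `X` that are adjacent
to `X`. By convention the Whitehead graph at the empty subtree has one vertex, the identity. -/
def WhVertex (X : FiniteSubtree α) : Type u :=
  {a : FreeGroup α // (a ∉ X.1 ∧ ∃ x ∈ X.1, (cayleyTree α).Adj x a) ∨ (X.1 = ∅ ∧ a = 1)}

/-- The shadow of `a` from `X`: the boundary points `ξ` such that the geodesic rays from `X` to `ξ`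
contain `a`. If `X` contains the identity and `a` is adjacent to `X`, this is the shadow of `a`
from the identity; if `X` is empty, it is the whole boundary. -/
def shadow (X : FiniteSubtree α) (a : FreeGroup α) : Set (Boundary α) :=
  {ξ | ∀ x ∈ X.1, OnRay x ξ a}

/-- The Whitehead graph of the line pattern at `X`, without multiplicities of edges: distinct `a`
and `b` are joined by an edge iff there is a line of the pattern between them, that is, with one
end point in the shadow of each. -/
def whiteheadGraph (W : Set (FreeGroup α)) (X : FiniteSubtree α) : SimpleGraph (WhVertex X) where
  Adj a b := a ≠ b ∧ ∃ l ∈ lines W, ∃ ξ ∈ shadow X a.1, ∃ η ∈ shadow X b.1,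
    IsEndOf ξ l ∧ IsEndOf η l
  symm := ⟨fun _ _ ⟨hne, l, hl, ξ, hξ, η, hη, h1, h2⟩ =>
    ⟨hne.symm, l, hl, η, hη, ξ, hξ, h2, h1⟩⟩
  loopless := ⟨fun _ h => h.1 rfl⟩

/-- A cover `𝒰_X` of the decomposition space associated to the finite subtree `X`. -/
structure WhCover (W : Set (FreeGroup α)) (X : FiniteSubtree α) where
  U : WhVertex X → Opens (DecompositionSpace W)
  isOpenCover : IsOpenCover U
  shadow_subset : ∀ a, proj W '' shadow X a.1 ⊆ U a
  inter_nonempty_iff : ∀ a b, a ≠ b →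
    (((U a : Set (DecompositionSpace W)) ∩ U b).Nonempty ↔ (whiteheadGraph W X).Adj a b)
  no_triple : ∀ a b c, a ≠ b → a ≠ c → b ≠ c →
    (U a : Set (DecompositionSpace W)) ∩ U b ∩ U c = ∅

/-- The underlying open cover. -/
def WhCover.cover {W : Set (FreeGroup α)} {X : FiniteSubtree α} (𝒰 : WhCover W X) :
    OpenCover (DecompositionSpace W) :=
  ⟨WhVertex X, 𝒰.U, 𝒰.isOpenCover⟩

end LinePattern

end

/-! The associated covers are swellings of the finite closed covers of 𝒟 by the images q(S(a)) of
the shadows. Distinct shadows are disjoint. A fibre of q has at most two points: lines that share an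
end have the same ends (`IsEndOf.of_common`, where a pigeonhole argument along the common ray gives
conjugates of the two words a common nontrivial power), and no line has three ends
(`IsEndOf.eq_of_three`). Hence q(S(a)) and q(S(b)) meet exactly when some line joins the two
shadows, and three such images never meet: the nerve is the Whitehead graph.

To pass to open sets, note that only finitely many lines join two disjoint cylinders
(`finite_lines_between`). So the fibre relation of q is closed, q is a closed map from a compact
Hausdorff space, and 𝒟 is normal; in a normal space a finite closed family swells to an open family
with the same nerve (`exists_swelling`). An associated cover may be cut down freely as long as it
keeps containing the shadow images, because each edge is witnessed by the ends of a line
(`WhCover.shrink`). This yields refinements, and compatible choices since a finite tree has finitely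
many subtrees.

Cofinality is the delicate point, since a member of an associated cover can be much larger than its
shadow image. Its extra points, however, lie in shadow images adjacent to its own in the Whitehead
graph, and a star-refinement argument with compactness controls these
(`exists_forall_whCover_refines`).

Surjectivity of the comparison map follows from cofinality alone. Injectivity also needs functorial
transition maps, that is, independence of the refinement function. In degrees 0 and 1 this is the
prism homotopy (`refineMap_eq_of_lt_two`). In degrees at least 2 an associated cover has no nonzero
alternating cochains, so there all the groups vanish. -/

namespace LinePattern

/-! ### Geometry of the Cayley tree: word length and the two sides of an edge -/

section Tree

variable {α : Type u}

theorem mk_singleton_inv (s : α × Bool) :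
    (FreeGroup.mk [s])⁻¹ = FreeGroup.mk [(s.1, !s.2)] := by
  simp [FreeGroup.inv_mk, FreeGroup.invRev]

theorem of_mul_mk_false (a : α) : FreeGroup.of a * FreeGroup.mk [(a, false)] = 1 := by
  rw [FreeGroup.of, mul_eq_one_iff_eq_inv, mk_singleton_inv]; rfl

theorem mk_false_mul_of (a : α) : FreeGroup.mk [(a, false)] * FreeGroup.of a = 1 := by
  rw [FreeGroup.of, mul_eq_one_iff_eq_inv, mk_singleton_inv]; rfl

theorem cayleyTree_adj {u v : FreeGroup α} :
    (cayleyTree α).Adj u v ↔ ∃ s : α × Bool, v = u * FreeGroup.mk [s] := by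
  classical
  rw [SimpleGraph.mulCayley_adj']
  constructor
  · rintro ⟨-, g, ⟨a, rfl⟩, h | h⟩
    · exact ⟨(a, true), h.symm⟩
    · refine ⟨(a, false), ?_⟩
      rw [h, mul_assoc, of_mul_mk_false, mul_one]
  · rintro ⟨⟨a, b⟩, rfl⟩
    refine ⟨fun h => ?_, FreeGroup.of a, ⟨a, rfl⟩, ?_⟩
    · have h1 : FreeGroup.mk [(a, b)] = 1 := by simpa using h.symm
      have := congrArg FreeGroup.norm h1
      simp [FreeGroup.norm, FreeGroup.reduce.cons] at this
    · cases b
      · right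
        rw [mul_assoc, mk_false_mul_of, mul_one]
      · left; rfl

theorem exists_walk (x : FreeGroup α) (L : List (α × Bool)) :
    ∃ p : (cayleyTree α).Walk x (x * FreeGroup.mk L), p.length = L.length := by
  induction L generalizing x with
  | nil => exact ⟨SimpleGraph.Walk.nil.copy rfl (by simp [← FreeGroup.one_eq_mk]), by simp⟩
  | cons s L ih =>
    obtain ⟨p, hp⟩ := ih (x * FreeGroup.mk [s])
    have h : x * FreeGroup.mk [s] * FreeGroup.mk L = x * FreeGroup.mk (s :: L) := by
      rw [mul_assoc, FreeGroup.mul_mk]; rfl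
    exact ⟨(SimpleGraph.Walk.cons (cayleyTree_adj.2 ⟨s, rfl⟩) p).copy rfl h, by simp [hp]⟩

section Norm

variable [DecidableEq α]

/-- Removing a letter from the left of a reduced word shortens it iff it is the first letter. -/
theorem toWord_inv_letter_mul (s : α × Bool) (z : FreeGroup α) :
    (∃ L, z.toWord = s :: L ∧ ((FreeGroup.mk [s])⁻¹ * z).toWord = L) ∨
      ((∀ L, z.toWord ≠ s :: L) ∧
        ((FreeGroup.mk [s])⁻¹ * z).toWord = (s.1, !s.2) :: z.toWord) := by
  rw [mk_singleton_inv, FreeGroup.toWord_mul, FreeGroup.toWord_mk, FreeGroup.reduce_singleton,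
    List.singleton_append, FreeGroup.reduce.cons, FreeGroup.reduce_toWord]
  rcases z.toWord with _ | ⟨h, L⟩
  · right; simp
  · by_cases hs : h = s
    · left; subst hs; exact ⟨L, rfl, by simp⟩
    · right
      refine ⟨fun L' h' => hs (List.cons.inj h').1, ?_⟩
      have : ¬ (s.1 = h.1 ∧ (!s.2) = !h.2) := by
        rintro ⟨h1, h2⟩; exact hs (Prod.ext h1.symm (by simpa using h2.symm))
      simp only [this, if_false]

theorem norm_inv_letter_mul_lt {s : α × Bool} {z : FreeGroup α} :
    ((FreeGroup.mk [s])⁻¹ * z).norm < z.norm ↔ ∃ L, z.toWord = s :: L := by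
  rcases toWord_inv_letter_mul s z with ⟨L, h1, h2⟩ | ⟨h1, h2⟩
  · simp [FreeGroup.norm, h1, h2, -FreeGroup.inv_mk]
  · simp [FreeGroup.norm, h1, h2, -FreeGroup.inv_mk]

theorem norm_inv_letter_mul (s : α × Bool) (z : FreeGroup α) :
    ((FreeGroup.mk [s])⁻¹ * z).norm + 1 = z.norm ∨
      ((FreeGroup.mk [s])⁻¹ * z).norm = z.norm + 1 := by
  rcases toWord_inv_letter_mul s z with ⟨L, h1, h2⟩ | ⟨h1, h2⟩
  · left; simp [FreeGroup.norm, h1, h2, -FreeGroup.inv_mk]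
  · right; simp [FreeGroup.norm, h2, -FreeGroup.inv_mk]

theorem norm_mul_letter_lt {t : α × Bool} {z : FreeGroup α} :
    (z * FreeGroup.mk [t]).norm < z.norm ↔ ∃ L, z.toWord = L ++ [(t.1, !t.2)] := by
  rw [← FreeGroup.norm_inv_eq, mul_inv_rev, ← z.norm_inv_eq, norm_inv_letter_mul_lt,
    FreeGroup.toWord_inv]
  constructor
  · rintro ⟨L, h⟩
    refine ⟨FreeGroup.invRev L, ?_⟩
    rw [← FreeGroup.invRev_invRev (L₁ := z.toWord), h]
    simp [FreeGroup.invRev]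
  · rintro ⟨L, h⟩
    exact ⟨FreeGroup.invRev L, by simp [h, FreeGroup.invRev]⟩

theorem norm_walk_le {x y : FreeGroup α} (p : (cayleyTree α).Walk x y) :
    (x⁻¹ * y).norm ≤ p.length := by
  induction p with
  | nil => simp
  | @cons x z y h p ih =>
    obtain ⟨s, rfl⟩ := cayleyTree_adj.1 h
    have h1 : x⁻¹ * y = FreeGroup.mk [s] * ((x * FreeGroup.mk [s])⁻¹ * y) := by group
    rw [h1, SimpleGraph.Walk.length_cons]
    have := FreeGroup.norm_mul_le (FreeGroup.mk [s]) ((x * FreeGroup.mk [s])⁻¹ * y)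
    have h2 : (FreeGroup.mk [s]).norm ≤ 1 := FreeGroup.norm_mk_le
    lia

theorem dist_eq_norm (x y : FreeGroup α) : (cayleyTree α).dist x y = (x⁻¹ * y).norm := by
  obtain ⟨p, hp⟩ := exists_walk x (x⁻¹ * y).toWord
  have hr : (cayleyTree α).Reachable x y := by
    simpa [FreeGroup.mk_toWord] using p.reachable
  obtain ⟨q, hq⟩ := hr.exists_walk_length_eq_dist
  refine le_antisymm ?_ (hq ▸ norm_walk_le q)
  have := SimpleGraph.dist_le p
  rw [hp] at this
  simpa [FreeGroup.mk_toWord] using! this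

/-- Splitting a reduced word without cancellation. -/
theorem norm_add_norm_eq_iff {v x : FreeGroup α} :
    v.norm + (v⁻¹ * x).norm = x.norm ↔ v.toWord <+: x.toWord := by
  constructor
  · intro h
    have h1 := FreeGroup.toWord_mul_sublist v (v⁻¹ * x)
    rw [mul_inv_cancel_left] at h1
    exact ⟨_, (h1.eq_of_length (by simpa [FreeGroup.norm] using h.symm)).symm⟩
  · rintro ⟨L, hL⟩
    have h1 : v⁻¹ * x = FreeGroup.mk L := by
      rw [← FreeGroup.mk_toWord (x := x), ← hL, ← FreeGroup.mul_mk, FreeGroup.mk_toWord,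
        inv_mul_cancel_left]
    have h2 : FreeGroup.IsReduced L :=
      (hL ▸ FreeGroup.isReduced_toWord : FreeGroup.IsReduced (v.toWord ++ L)).infix
        (List.suffix_append _ _).isInfix
    rw [h1, FreeGroup.norm, FreeGroup.norm, FreeGroup.norm, FreeGroup.toWord_mk, h2.reduce_eq, ← hL,
      List.length_append]

end Norm

theorem connected_cayleyTree : (cayleyTree α).Connected := by
  classical
  refine ⟨fun x y => ?_⟩
  obtain ⟨p, -⟩ := exists_walk x (x⁻¹ * y).toWord
  simpa [FreeGroup.mk_toWord] using p.reachable

theorem dist_mul_left (g x y : FreeGroup α) :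
    (cayleyTree α).dist (g * x) (g * y) = (cayleyTree α).dist x y := by
  classical
  rw [dist_eq_norm, dist_eq_norm]
  congr 1
  group

theorem finite_ball [Finite α] (x : FreeGroup α) (n : ℕ) :
    {y | (cayleyTree α).dist x y ≤ n}.Finite := by
  classical
  have h : {z : FreeGroup α | z.norm ≤ n}.Finite :=
    (List.finite_length_le (α × Bool) n).preimage FreeGroup.toWord_injective.injOn
  refine (h.preimage (mul_right_injective x⁻¹).injOn).subset fun y hy => ?_
  simpa [dist_eq_norm] using hy

/-- The vertices on the side of `a` of the edge joining `p` and `a`. -/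
def cone (p a : FreeGroup α) : Set (FreeGroup α) :=
  {y | (cayleyTree α).dist a y < (cayleyTree α).dist p y}

variable {p a b x y z : FreeGroup α}

/-- Multiplication by one letter changes the reduced length by exactly one, so no vertex is
equidistant from the ends of an edge. Hence `cone p a` and `cone a p` are complementary. -/
theorem dist_of_adj (h : (cayleyTree α).Adj p a) (y : FreeGroup α) :
    (cayleyTree α).dist a y + 1 = (cayleyTree α).dist p y ∨
      (cayleyTree α).dist a y = (cayleyTree α).dist p y + 1 := by
  classical
  obtain ⟨s, rfl⟩ := cayleyTree_adj.1 h
  simpa [dist_eq_norm, mul_assoc] using norm_inv_letter_mul s (p⁻¹ * y)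

theorem dist_of_mem_cone (h : (cayleyTree α).Adj p a) (hy : y ∈ cone p a) :
    (cayleyTree α).dist p y = (cayleyTree α).dist a y + 1 := by
  have := dist_of_adj h y
  have h1 : (cayleyTree α).dist a y < (cayleyTree α).dist p y := hy
  lia

theorem dist_of_notMem_cone (h : (cayleyTree α).Adj p a) (hy : y ∉ cone p a) :
    (cayleyTree α).dist a y = (cayleyTree α).dist p y + 1 := by
  have := dist_of_adj h y
  have h1 : ¬ (cayleyTree α).dist a y < (cayleyTree α).dist p y := hy
  lia

theorem notMem_cone_left (p a : FreeGroup α) : p ∉ cone p a := by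
  simp [cone]

/-- An edge from the inside to the outside of a cone is the edge that defines it. -/
theorem eq_of_cone_crossing (h : (cayleyTree α).Adj p a) (hyz : (cayleyTree α).Adj y z)
    (hy : y ∈ cone p a) (hz : z ∉ cone p a) : y = a ∧ z = p := by
  classical
  have h1 := dist_of_mem_cone h hy
  have h2 := dist_of_notMem_cone h hz
  have h3 := dist_of_adj hyz p
  have h4 := dist_of_adj hyz a
  rw [SimpleGraph.dist_comm (v := p), SimpleGraph.dist_comm (v := p)] at h3
  rw [SimpleGraph.dist_comm (v := a), SimpleGraph.dist_comm (v := a)] at h4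
  have hy' : (cayleyTree α).dist a y < (cayleyTree α).dist p y := hy
  -- The step from y to z moves towards p but away from a: its letter cancels the last letter of
  -- p⁻¹y and not that of a⁻¹y. The word of a⁻¹y is the word of p⁻¹y without its first letter, so if
  -- it were nonempty the two would end in the same letter. It is therefore empty, and y = a.
  have h5 : (cayleyTree α).dist p z < (cayleyTree α).dist p y := by lia
  have h6 : ¬ (cayleyTree α).dist a z < (cayleyTree α).dist a y := by lia
  obtain ⟨s, rfl⟩ := cayleyTree_adj.1 h
  obtain ⟨t, rfl⟩ := cayleyTree_adj.1 hyz
  rw [dist_eq_norm, dist_eq_norm, ← mul_assoc] at h5 h6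
  rw [norm_mul_letter_lt] at h5 h6
  rw [dist_eq_norm, dist_eq_norm, mul_inv_rev, mul_assoc, norm_inv_letter_mul_lt] at hy'
  obtain ⟨L, hL⟩ := hy'
  obtain ⟨M, hM⟩ := h5
  have h7 : ((p * FreeGroup.mk [s])⁻¹ * y).toWord = L := by
    rcases toWord_inv_letter_mul s (p⁻¹ * y) with ⟨L', h1, h2⟩ | ⟨h1, h2⟩
    · rw [mul_inv_rev, mul_assoc, h2]
      exact (List.cons.inj (h1.symm.trans hL)).2
    · exact absurd hL (h1 L)
  have hLnil : L = [] := by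
    rcases List.eq_nil_or_concat L with h | ⟨L', t', rfl⟩
    · exact h
    · rw [List.concat_eq_append] at *
      rw [hL, ← List.cons_append] at hM
      obtain ⟨-, h⟩ := List.append_inj' hM rfl
      rw [h] at h7
      exact absurd ⟨L', h7⟩ h6
  rw [hLnil] at h7
  have hya : y = p * FreeGroup.mk [s] := by
    rw [FreeGroup.toWord_eq_nil_iff] at h7
    exact (inv_mul_eq_one.1 h7).symm
  refine ⟨hya, ?_⟩
  subst hya
  have h8 : (cayleyTree α).dist p (p * FreeGroup.mk [s] * FreeGroup.mk [t]) = 0 := by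
    have := (SimpleGraph.dist_eq_one_iff_adj (G := cayleyTree α)).2 h
    lia
  exact (connected_cayleyTree.dist_eq_zero_iff.1 h8).symm

theorem eq_of_mem_cone (ha : (cayleyTree α).Adj p a) (hb : (cayleyTree α).Adj p b)
    (h1 : y ∈ cone p a) (h2 : y ∈ cone p b) : a = b := by
  classical
  obtain ⟨s, rfl⟩ := cayleyTree_adj.1 ha
  obtain ⟨t, rfl⟩ := cayleyTree_adj.1 hb
  simp only [cone, Set.mem_ofPred_eq, dist_eq_norm, mul_inv_rev, mul_assoc,
    norm_inv_letter_mul_lt] at h1 h2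
  obtain ⟨L, hL⟩ := h1
  obtain ⟨M, hM⟩ := h2
  rw [(List.cons.inj (hL.symm.trans hM)).1]

theorem exists_adj_mem_cone (h : p ≠ y) : ∃ a, (cayleyTree α).Adj p a ∧ y ∈ cone p a := by
  classical
  rcases hw : (p⁻¹ * y).toWord with _ | ⟨s, L⟩
  · exact absurd (inv_mul_eq_one.1 (FreeGroup.toWord_eq_nil_iff.1 hw)) h
  · refine ⟨p * FreeGroup.mk [s], cayleyTree_adj.2 ⟨s, rfl⟩, ?_⟩
    simp only [cone, Set.mem_ofPred_eq, dist_eq_norm, mul_inv_rev, mul_assoc,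
      norm_inv_letter_mul_lt]
    exact ⟨L, hw⟩

/-- The edge that defines a cone separates the cone from its complement. -/
theorem dist_of_cone_separates (h : (cayleyTree α).Adj p a) (hx : x ∈ cone p a)
    (hy : y ∉ cone p a) : (cayleyTree α).dist x y =
      (cayleyTree α).dist x a + 1 + (cayleyTree α).dist p y := by
  refine le_antisymm ?_ ?_
  · have h1 := connected_cayleyTree.dist_triangle (u := x) (v := a) (w := y)
    have := dist_of_notMem_cone h hy
    lia
  · obtain ⟨q, hq⟩ := connected_cayleyTree.exists_walk_length_eq_dist x y
    rw [← hq]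
    clear hq
    -- The lower bound holds for the length of every walk from x to y: such a walk must leave the
    -- cone, and `eq_of_cone_crossing` says that it does so along the edge from a to p.
    induction q with
    | nil => exact absurd hx hy
    | @cons x z y hxz q ih =>
      rw [SimpleGraph.Walk.length_cons]
      by_cases hz : z ∈ cone p a
      · have := ih hz hy
        have h1 := connected_cayleyTree.dist_triangle (u := x) (v := z) (w := a)
        have h2 := (SimpleGraph.dist_eq_one_iff_adj (G := cayleyTree α)).2 hxz
        lia
      · obtain ⟨rfl, rfl⟩ := eq_of_cone_crossing h hxz hx hz
        have := SimpleGraph.dist_le q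
        simp only [SimpleGraph.dist_self]
        lia

theorem mem_cone_iff_onSegment (h : (cayleyTree α).Adj p a) :
    y ∈ cone p a ↔ OnSegment p y a := by
  have h1 := (SimpleGraph.dist_eq_one_iff_adj (G := cayleyTree α)).2 h
  constructor
  · intro hy
    have := dist_of_mem_cone h hy
    rw [OnSegment]
    lia
  · intro hy
    rw [OnSegment] at hy
    change (cayleyTree α).dist a y < (cayleyTree α).dist p y
    lia

theorem onSegment_of_mem_cone (h : (cayleyTree α).Adj p a) (hx : x ∉ cone p a)
    (hy : y ∈ cone p a) : OnSegment x y a := by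
  have h1 := dist_of_cone_separates h hy hx
  have h2 := dist_of_notMem_cone h hx
  rw [OnSegment, SimpleGraph.dist_comm (u := x) (v := a), SimpleGraph.dist_comm (u := x) (v := y),
    SimpleGraph.dist_comm (u := a) (v := y)]
  lia

theorem OnSegment.trans (h1 : OnSegment x y a) (h2 : OnSegment x a b) : OnSegment x y b := by
  have h3 := connected_cayleyTree.dist_triangle (u := b) (v := a) (w := y)
  have h4 := connected_cayleyTree.dist_triangle (u := x) (v := b) (w := y)
  rw [OnSegment] at *
  lia

/-- Vertices on a geodesic from the identity are prefixes of one reduced word, and prefixes of equal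
length coincide. -/
theorem OnSegment.eq_of_dist_eq (h1 : OnSegment 1 y a) (h2 : OnSegment 1 y b)
    (h : (cayleyTree α).dist 1 a = (cayleyTree α).dist 1 b) : a = b := by
  classical
  simp only [OnSegment, dist_eq_norm, inv_one, one_mul, norm_add_norm_eq_iff] at h1 h2 h
  exact FreeGroup.toWord_injective
    ((List.prefix_of_prefix_length_le h1 h2 h.le).eq_of_length h)

end Tree

end LinePattern

namespace LinePattern

/-! ### Vertices of geodesic rays from the identity -/

section Rays

variable {α : Type u} {ξ η : Boundary α} {x : FreeGroup α} {m n : ℕ}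

theorem Boundary.toWord_vertex [DecidableEq α] (ξ : Boundary α) (n : ℕ) :
    (ξ.vertex n).toWord = List.ofFn fun i : Fin n => ξ.1 i := by
  rw [Boundary.vertex, FreeGroup.toWord_mk]
  apply FreeGroup.IsReduced.reduce_eq
  rw [FreeGroup.IsReduced, List.isChain_iff_getElem]
  intro i hi
  simpa using ξ.2 i

theorem Boundary.dist_one_vertex (ξ : Boundary α) (n : ℕ) :
    (cayleyTree α).dist 1 (ξ.vertex n) = n := by
  classical
  simp [dist_eq_norm, FreeGroup.norm, ξ.toWord_vertex]

theorem Boundary.vertex_succ (ξ : Boundary α) (n : ℕ) :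
    ξ.vertex (n + 1) = ξ.vertex n * FreeGroup.mk [ξ.1 n] := by
  rw [Boundary.vertex, Boundary.vertex, FreeGroup.mul_mk, List.ofFn_succ']
  simp

theorem Boundary.adj_vertex (ξ : Boundary α) (n : ℕ) :
    (cayleyTree α).Adj (ξ.vertex n) (ξ.vertex (n + 1)) :=
  cayleyTree_adj.2 ⟨_, ξ.vertex_succ n⟩

theorem Boundary.vertex_eq_iff :
    ξ.vertex n = η.vertex n ↔ ∀ i < n, ξ.1 i = η.1 i := by
  classical
  rw [← FreeGroup.toWord_inj, ξ.toWord_vertex, η.toWord_vertex, List.ofFn_inj, funext_iff]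
  exact ⟨fun h i hi => h ⟨i, hi⟩, fun h i => h i i.2⟩

theorem Boundary.vertex_eq_of_le (h : ξ.vertex n = η.vertex n) (hmn : m ≤ n) :
    ξ.vertex m = η.vertex m :=
  Boundary.vertex_eq_iff.2 fun i hi => Boundary.vertex_eq_iff.1 h i (hi.trans_le hmn)

theorem Boundary.exists_vertex_ne (h : ξ ≠ η) : ∃ n, ξ.vertex n ≠ η.vertex n := by
  by_contra! h'
  exact h (Subtype.ext (funext fun i => Boundary.vertex_eq_iff.1 (h' (i + 1)) i i.lt_succ_self))

theorem Boundary.onSegment_vertex (ξ : Boundary α) (h : m ≤ n) :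
    OnSegment 1 (ξ.vertex n) (ξ.vertex m) := by
  classical
  simp only [OnSegment, dist_eq_norm, inv_one, one_mul, norm_add_norm_eq_iff, ξ.toWord_vertex]
  obtain ⟨k, rfl⟩ := Nat.exists_eq_add_of_le h
  exact ⟨_, (List.ofFn_add (f := fun i : Fin (m + k) => ξ.1 i)).symm⟩

/-- Two rays from the identity that pass through the geodesic from `1` to `x` agree there. -/
theorem Boundary.vertex_eq_of_onSegment (h1 : OnSegment 1 x (ξ.vertex n))
    (h2 : OnSegment 1 x (η.vertex n)) : ξ.vertex n = η.vertex n :=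
  h1.eq_of_dist_eq h2 (by rw [dist_one_vertex, dist_one_vertex])

theorem Boundary.onSegment_of_le (h : OnSegment 1 x (ξ.vertex n)) (hmn : m ≤ n) :
    OnSegment 1 x (ξ.vertex m) :=
  h.trans (ξ.onSegment_vertex hmn)

theorem Boundary.le_dist_of_onSegment (h : OnSegment 1 x (ξ.vertex n)) :
    n ≤ (cayleyTree α).dist 1 x := by
  rw [OnSegment, dist_one_vertex] at h
  lia

/-- Turns the condition that defines `IsEndOf` into membership in a cone, to which the separation
lemmas apply. -/
theorem Boundary.mem_cone_vertex :
    x ∈ cone (ξ.vertex n) (ξ.vertex (n + 1)) ↔ OnSegment 1 x (ξ.vertex (n + 1)) := by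
  constructor
  · refine onSegment_of_mem_cone (ξ.adj_vertex n) fun h => ?_
    have h1 := dist_of_mem_cone (ξ.adj_vertex n) h
    rw [SimpleGraph.dist_comm, dist_one_vertex, SimpleGraph.dist_comm, dist_one_vertex] at h1
    lia
  · intro h
    have h1 := connected_cayleyTree.dist_triangle (u := 1) (v := ξ.vertex n) (w := x)
    rw [OnSegment] at h
    rw [dist_one_vertex] at h h1
    change (cayleyTree α).dist _ _ < (cayleyTree α).dist _ _
    lia

end Rays

/-! ### The boundary as a compact Hausdorff space with a basis of cylinders -/

section Topology

variable {α : Type u}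

theorem Boundary.isOpen_setOf_vertex (n : ℕ) (P : FreeGroup α → Prop) :
    IsOpen {ξ : Boundary α | P (ξ.vertex n)} := by
  let : TopologicalSpace (α × Bool) := ⊥
  have : DiscreteTopology (α × Bool) := ⟨rfl⟩
  have h1 : Continuous fun ξ : Boundary α => fun i : Fin n => ξ.1 i :=
    continuous_pi fun i => (continuous_apply (i : ℕ)).comp continuous_induced_dom
  have h2 := (isOpen_discrete {f : Fin n → α × Bool | P (FreeGroup.mk (List.ofFn f))}).preimage h1
  exact h2

theorem Boundary.isClosed_setOf_vertex (n : ℕ) (P : FreeGroup α → Prop) :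
    IsClosed {ξ : Boundary α | P (ξ.vertex n)} :=
  ⟨Boundary.isOpen_setOf_vertex n fun x => ¬ P x⟩

theorem Boundary.exists_cylinder_subset {U : Set (Boundary α)} (hU : IsOpen U) {ξ : Boundary α}
    (hξ : ξ ∈ U) : ∃ n, ∀ η : Boundary α, η.vertex n = ξ.vertex n → η ∈ U := by
  let : TopologicalSpace (α × Bool) := ⊥
  have : DiscreteTopology (α × Bool) := ⟨rfl⟩
  obtain ⟨V, hV, rfl⟩ := isOpen_induced_iff.1 hU
  obtain ⟨I, u, hu, hIV⟩ := isOpen_pi_iff.1 hV ξ.1 hξ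
  refine ⟨I.sup id + 1, fun η hη => hIV fun i hi => ?_⟩
  have h1 : i < I.sup id + 1 := Nat.lt_succ_of_le (Finset.le_sup (f := id) hi)
  rw [Boundary.vertex_eq_iff.1 hη i h1]
  exact (hu i hi).2

instance : T2Space (Boundary α) := by
  let : TopologicalSpace (α × Bool) := ⊥
  have : DiscreteTopology (α × Bool) := ⟨rfl⟩
  exact Topology.IsEmbedding.t2Space (Topology.IsEmbedding.subtypeVal (p := fun ξ : ℕ → α × Bool =>
    ∀ n, (ξ n).1 = (ξ (n + 1)).1 → (ξ n).2 = (ξ (n + 1)).2))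

instance [Finite α] : CompactSpace (Boundary α) := by
  let : TopologicalSpace (α × Bool) := ⊥
  have : DiscreteTopology (α × Bool) := ⟨rfl⟩
  have h : IsClosed {ξ : ℕ → α × Bool |
      ∀ n, (ξ n).1 = (ξ (n + 1)).1 → (ξ n).2 = (ξ (n + 1)).2} := by
    simp only [Set.ofPred_forall]
    refine isClosed_iInter fun n => ?_
    have h1 : Continuous fun ξ : ℕ → α × Bool => (ξ n, ξ (n + 1)) := by fun_prop
    exact (isClosed_discrete {p : (α × Bool) × (α × Bool) |
      p.1.1 = p.2.1 → p.1.2 = p.2.2}).preimage h1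
  exact isCompact_iff_compactSpace.1 h.isCompact

end Topology

/-! ### End points of lines -/

section Ends

variable {α : Type u} {W : Set (FreeGroup α)} {ξ η ζ : Boundary α} {l l' : Set (FreeGroup α)}

theorem isClosed_setOf_isEndOf (l : Set (FreeGroup α)) :
    IsClosed {ξ : Boundary α | IsEndOf ξ l} := by
  simp only [IsEndOf, Set.ofPred_forall]
  exact isClosed_iInter fun n =>
    Boundary.isClosed_setOf_vertex n fun v => ∃ x ∈ l, OnSegment 1 x v

theorem dist_mul_zpow_succ (g w : FreeGroup α) (k : ℤ) :
    (cayleyTree α).dist (g * w ^ k) (g * w ^ (k + 1)) = (cayleyTree α).dist 1 w := by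
  conv_lhs => rw [← mul_one (g * w ^ k), zpow_add_one, ← mul_assoc, dist_mul_left]

theorem exists_int_and_not_succ {P : ℤ → Prop} {i j : ℤ} (hi : P i) (hj : ¬ P j) (hij : i ≤ j) :
    ∃ k, i ≤ k ∧ k < j ∧ P k ∧ ¬ P (k + 1) := by
  by_contra! h
  refine hj (Int.leInduction (m := i) (motive := fun n _ => n ≤ j → P n) (fun _ => hi)
    (fun n hn ih hnj => ?_) j hij le_rfl)
  exact h n hn (by lia) (ih (by lia))

/-- A line of the pattern that has points on both sides of an edge passes near this edge. -/
theorem exists_dist_le_of_cone {p a g w : FreeGroup α} (h : (cayleyTree α).Adj p a) {i j : ℤ}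
    (hi : g * w ^ i ∈ cone p a) (hj : g * w ^ j ∉ cone p a) :
    ∃ k, min i j ≤ k ∧ k ≤ max i j ∧
      (cayleyTree α).dist p (g * w ^ k) ≤ (cayleyTree α).dist 1 w := by
  -- Two consecutive points of the line lie on different sides of the edge. Their distance is the
  -- length of w, and the geodesic between them runs through p, so the one outside the cone is
  -- within that length of p.
  rcases le_total i j with hij | hij
  · obtain ⟨k, h1, h2, h3, h4⟩ := exists_int_and_not_succ
      (P := fun k => g * w ^ k ∈ cone p a) hi hj hij
    have := dist_of_cone_separates h h3 h4
    rw [dist_mul_zpow_succ] at this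
    exact ⟨k + 1, by lia, by lia, by lia⟩
  · obtain ⟨k, h1, h2, h3, h4⟩ := exists_int_and_not_succ
      (P := fun k => g * w ^ k ∉ cone p a) hj (not_not.2 hi) hij
    have := dist_of_cone_separates h (not_not.1 h4) h3
    rw [SimpleGraph.dist_comm, dist_mul_zpow_succ] at this
    exact ⟨k, by lia, by lia, by lia⟩

theorem range_eq_of_mem {g w z : FreeGroup α} (hz : z ∈ Set.range fun k : ℤ => g * w ^ k) :
    (Set.range fun k : ℤ => g * w ^ k) = Set.range fun k : ℤ => z * w ^ k := by
  obtain ⟨j, rfl⟩ := hz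
  ext x
  constructor
  · rintro ⟨k, rfl⟩
    exact ⟨k - j, by simp [mul_assoc, ← zpow_add]⟩
  · rintro ⟨k, rfl⟩
    exact ⟨j + k, by simp [mul_assoc, zpow_add]⟩

/-- The rays to the ends of a line eventually stay near the line. -/
theorem IsEndOf.exists_dist_le {g w : FreeGroup α}
    (h : IsEndOf ξ (Set.range fun k : ℤ => g * w ^ k)) {n : ℕ}
    (hn : (cayleyTree α).dist 1 g ≤ n) :
    ∃ k : ℤ, (cayleyTree α).dist (ξ.vertex n) (g * w ^ k) ≤ (cayleyTree α).dist 1 w := by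
  obtain ⟨-, ⟨i, rfl⟩, hi⟩ := h (n + 1)
  -- The base point g is too close to the identity to lie beyond the vertex n + 1, so the line
  -- crosses the edge from vertex n to vertex n + 1.
  have h0 : g * w ^ (0 : ℤ) ∉ cone (ξ.vertex n) (ξ.vertex (n + 1)) := by
    rw [Boundary.mem_cone_vertex, zpow_zero, mul_one]
    intro h
    have := Boundary.le_dist_of_onSegment h
    lia
  obtain ⟨k, -, -, hk⟩ := exists_dist_le_of_cone (ξ.adj_vertex n)
    (Boundary.mem_cone_vertex.2 hi) h0
  exact ⟨k, hk⟩

/-- The ends of a line only depend on the line up to bounded distance. -/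
theorem IsEndOf.of_dist_le (h : IsEndOf ξ l) {C : ℕ}
    (hl : ∀ x ∈ l, ∃ y ∈ l', (cayleyTree α).dist x y ≤ C) : IsEndOf ξ l' := by
  intro n
  rcases n with _ | n
  · obtain ⟨x, hx, -⟩ := h 0
    obtain ⟨y, hy, -⟩ := hl x hx
    exact ⟨y, hy, by simp [OnSegment, Boundary.vertex, ← FreeGroup.one_eq_mk]⟩
  -- The extra depth C is what a point y within C of x would have to travel back to leave the cone
  -- at the vertex n + 1; crossing the edge then costs one more.
  obtain ⟨x, hx, hξ⟩ := h (n + 1 + C)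
  obtain ⟨y, hy, hxy⟩ := hl x hx
  refine ⟨y, hy, ?_⟩
  by_contra hy'
  have h1 := Boundary.onSegment_of_le hξ (Nat.le_add_right (n + 1) C)
  rw [← Boundary.mem_cone_vertex] at h1 hy'
  have h2 := dist_of_cone_separates (ξ.adj_vertex n) h1 hy'
  have h3 := Boundary.le_dist_of_onSegment hξ
  have h4 := connected_cayleyTree.dist_triangle (u := 1) (v := ξ.vertex (n + 1)) (w := x)
  rw [Boundary.dist_one_vertex, SimpleGraph.dist_comm (u := ξ.vertex (n + 1))] at h4
  lia

/-- The common power translates both lines along themselves. Modulo this translation the first line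
has |a| points, so it stays within bounded distance of the second; the sum over residues serves as a
bound for the maximum. -/
theorem IsEndOf.of_zpow_eq {g₁ g₂ w₁ w₂ : FreeGroup α} {a b : ℤ} (ha : a ≠ 0)
    (hab : (g₁ * w₁ * g₁⁻¹) ^ a = (g₂ * w₂ * g₂⁻¹) ^ b)
    (h : IsEndOf ξ (Set.range fun k : ℤ => g₁ * w₁ ^ k)) :
    IsEndOf ξ (Set.range fun k : ℤ => g₂ * w₂ ^ k) := by
  set f : ℤ → ℕ := fun s => (cayleyTree α).dist (g₁ * w₁ ^ s) g₂ with hf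
  refine h.of_dist_le (C := ∑ s ∈ Finset.Ico 0 |a|, f s) ?_
  rintro - ⟨k, rfl⟩
  have key : (g₁ * w₁ * g₁⁻¹) ^ (a * (k / a)) = (g₂ * w₂ * g₂⁻¹) ^ (b * (k / a)) := by
    rw [zpow_mul, hab, zpow_mul]
  rw [conj_zpow, conj_zpow] at key
  refine ⟨_, ⟨b * (k / a), rfl⟩, ?_⟩
  have h1 : g₁ * w₁ ^ k = (g₁ * w₁ ^ (a * (k / a)) * g₁⁻¹) * (g₁ * w₁ ^ (k % a)) := by
    conv_lhs => rw [← Int.mul_ediv_add_emod k a, zpow_add]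
    group
  have h2 : g₂ * w₂ ^ (b * (k / a)) = (g₁ * w₁ ^ (a * (k / a)) * g₁⁻¹) * g₂ := by
    rw [key]; group
  beta_reduce
  rw [h1, h2, dist_mul_left]
  exact Finset.single_le_sum (f := f) (fun _ _ => Nat.zero_le _)
    (Finset.mem_Ico.2 ⟨Int.emod_nonneg k ha, Int.emod_lt_abs k ha⟩)

/-- Two lines with a common end have the same ends. -/
theorem IsEndOf.of_common [Finite α] (hl : l ∈ lines W) (hl' : l' ∈ lines W) (h : IsEndOf ξ l)
    (h' : IsEndOf ξ l') (hη : IsEndOf η l) : IsEndOf η l' := by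
  obtain ⟨w₁, -, g₁, rfl⟩ := hl
  obtain ⟨w₂, -, g₂, rfl⟩ := hl'
  set N := max ((cayleyTree α).dist 1 g₁) ((cayleyTree α).dist 1 g₂)
  have h1 : ∀ n : ℕ, ∃ k : ℤ, (cayleyTree α).dist (ξ.vertex (N + n)) (g₁ * w₁ ^ k) ≤
      (cayleyTree α).dist 1 w₁ := fun n => h.exists_dist_le (by lia)
  have h2 : ∀ n : ℕ, ∃ k : ℤ, (cayleyTree α).dist (ξ.vertex (N + n)) (g₂ * w₂ ^ k) ≤
      (cayleyTree α).dist 1 w₂ := fun n => h'.exists_dist_le (by lia)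
  choose i hi using h1
  choose j hj using h2
  have hfin := (finite_ball (1 : FreeGroup α) ((cayleyTree α).dist 1 w₁)).prod
    (finite_ball (1 : FreeGroup α) ((cayleyTree α).dist 1 w₂))
  -- Pigeonhole: seen from the vertices of the ray, the nearby points of both lines take finitely
  -- many relative positions, so two vertices show the same pair. The translation between these
  -- vertices is then a power of both conjugates.
  obtain ⟨m, -, n, -, hmn, he⟩ := Set.infinite_univ.exists_ne_map_eq_of_mapsTo
    (f := fun n => ((ξ.vertex (N + n))⁻¹ * (g₁ * w₁ ^ i n), (ξ.vertex (N + n))⁻¹ * (g₂ * w₂ ^ j n)))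
    (fun n _ => Set.mk_mem_prod
      (by simpa using! (dist_mul_left (ξ.vertex (N + n))⁻¹ _ _).trans_le (hi n))
      (by simpa using! (dist_mul_left (ξ.vertex (N + n))⁻¹ _ _).trans_le (hj n))) hfin
  obtain ⟨e1, e2⟩ := Prod.mk.inj he
  have e3 : ξ.vertex (N + n) * (ξ.vertex (N + m))⁻¹ = (g₁ * w₁ * g₁⁻¹) ^ (i n - i m) := by
    rw [conj_zpow, zpow_sub]
    calc _ = ξ.vertex (N + n) * ((ξ.vertex (N + m))⁻¹ * (g₁ * w₁ ^ i m)) * (g₁ * w₁ ^ i m)⁻¹ := by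
          group
      _ = _ := by rw [e1]; group
  have e4 : ξ.vertex (N + n) * (ξ.vertex (N + m))⁻¹ = (g₂ * w₂ * g₂⁻¹) ^ (j n - j m) := by
    rw [conj_zpow, zpow_sub]
    calc _ = ξ.vertex (N + n) * ((ξ.vertex (N + m))⁻¹ * (g₂ * w₂ ^ j m)) * (g₂ * w₂ ^ j m)⁻¹ := by
          group
      _ = _ := by rw [e2]; group
  -- The exponent is nonzero because the two vertices have different distances from the identity.
  refine hη.of_zpow_eq (a := i n - i m) (fun h0 => ?_) (e3.symm.trans e4)
  rw [h0, zpow_zero, mul_inv_eq_one] at e3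
  have := congrArg ((cayleyTree α).dist 1) e3
  rw [Boundary.dist_one_vertex, Boundary.dist_one_vertex] at this
  lia

/-- A line has at most two ends. -/
theorem IsEndOf.eq_of_three [Finite α] (hl : l ∈ lines W) (hξ : IsEndOf ξ l) (hη : IsEndOf η l)
    (hζ : IsEndOf ζ l) : ξ = η ∨ ξ = ζ ∨ η = ζ := by
  obtain ⟨w, -, g, rfl⟩ := hl
  by_contra! hne
  obtain ⟨n₁, h₁⟩ := Boundary.exists_vertex_ne hne.1
  obtain ⟨n₂, h₂⟩ := Boundary.exists_vertex_ne hne.2.1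
  obtain ⟨n₃, h₃⟩ := Boundary.exists_vertex_ne hne.2.2
  set N := max n₁ (max n₂ n₃)
  replace h₁ := mt (Boundary.vertex_eq_of_le (m := n₁) (n := N + 1) · (by lia)) h₁
  replace h₂ := mt (Boundary.vertex_eq_of_le (m := n₂) (n := N + 1) · (by lia)) h₂
  replace h₃ := mt (Boundary.vertex_eq_of_le (m := n₃) (n := N + 1) · (by lia)) h₃
  have hw : w ≠ 1 := by
    rintro rfl
    obtain ⟨-, ⟨k, rfl⟩, hk⟩ := hξ ((cayleyTree α).dist 1 g + 1)
    have := Boundary.le_dist_of_onSegment hk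
    simp only [one_zpow, mul_one] at this
    lia
  have hinj : Function.Injective fun k : ℤ => g * w ^ k :=
    (mul_right_injective g).comp
      (injective_zpow_iff_not_isOfFinOrder.2 (not_isOfFinOrder_of_isMulTorsionFree hw))
  -- Each end captures a whole tail of the line, positive or negative. With three ends, two share a
  -- tail and hence their vertex at depth N + 1, which was chosen to distinguish all three.
  have hside : ∀ θ : Boundary α, IsEndOf θ (Set.range fun k : ℤ => g * w ^ k) →
      ∃ B : ℤ, (∀ k, B ≤ k → OnSegment 1 (g * w ^ k) (θ.vertex (N + 1))) ∨
        (∀ k, k ≤ -B → OnSegment 1 (g * w ^ k) (θ.vertex (N + 1))) := by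
    intro θ hθ
    have hfin : {k : ℤ | (cayleyTree α).dist (θ.vertex N) (g * w ^ k) ≤
        (cayleyTree α).dist 1 w}.Finite := (finite_ball _ _).preimage hinj.injOn
    obtain ⟨B₁, hB₁⟩ := hfin.bddAbove
    obtain ⟨B₂, hB₂⟩ := hfin.bddBelow
    set B := max (|B₁|) (|B₂|) + 1
    have hB : ∀ k, (cayleyTree α).dist (θ.vertex N) (g * w ^ k) ≤
        (cayleyTree α).dist 1 w → -B < k ∧ k < B := by
      intro k hk
      have h1 : k ≤ B₁ := hB₁ hk
      have h2 : B₂ ≤ k := hB₂ hk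
      have := le_abs_self B₁
      have := neg_abs_le B₂
      lia
    refine ⟨B, ?_⟩
    -- D bounds the distance from 1 of every point with index in (-B, B). A point of the line beyond
    -- depth N + 1 + D thus has index outside this range, where by the choice of B the line no
    -- longer crosses the edge.
    set D := ∑ k ∈ Finset.Ioo (-B) B, (cayleyTree α).dist 1 (g * w ^ k)
    obtain ⟨-, ⟨i, rfl⟩, hi⟩ := hθ (N + 1 + D + 1)
    have hi' := Boundary.onSegment_of_le hi (m := N + 1) (by lia)
    have hiB : i ∉ Finset.Ioo (-B) B := fun hmem => by
      have h1 := Boundary.le_dist_of_onSegment hi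
      have h2 := Finset.single_le_sum (f := fun k => (cayleyTree α).dist 1 (g * w ^ k))
        (fun _ _ => Nat.zero_le _) hmem
      beta_reduce at h1 h2
      lia
    rw [Finset.mem_Ioo, not_and_or, not_lt, not_lt] at hiB
    simp only [← Boundary.mem_cone_vertex] at hi' ⊢
    rcases hiB with hiB | hiB
    · right
      intro k hk
      by_contra hk'
      obtain ⟨j, hj1, hj2, hj3⟩ := exists_dist_le_of_cone (θ.adj_vertex N) hi' hk'
      have := hB j hj3
      lia
    · left
      intro k hk
      by_contra hk'
      obtain ⟨j, hj1, hj2, hj3⟩ := exists_dist_le_of_cone (θ.adj_vertex N) hi' hk'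
      have := hB j hj3
      lia
  have hpos : ∀ {θ θ' : Boundary α}, θ.vertex (N + 1) ≠ θ'.vertex (N + 1) → ∀ B B' : ℤ,
      (∀ k, B ≤ k → OnSegment 1 (g * w ^ k) (θ.vertex (N + 1))) →
      (∀ k, B' ≤ k → OnSegment 1 (g * w ^ k) (θ'.vertex (N + 1))) → False :=
    fun hne B B' h h' => hne (Boundary.vertex_eq_of_onSegment (h _ (le_max_left B B'))
      (h' _ (le_max_right B B')))
  have hneg : ∀ {θ θ' : Boundary α}, θ.vertex (N + 1) ≠ θ'.vertex (N + 1) → ∀ B B' : ℤ,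
      (∀ k, k ≤ -B → OnSegment 1 (g * w ^ k) (θ.vertex (N + 1))) →
      (∀ k, k ≤ -B' → OnSegment 1 (g * w ^ k) (θ'.vertex (N + 1))) → False :=
    fun hne B B' h h' => hne (Boundary.vertex_eq_of_onSegment (h _ (min_le_left (-B) (-B')))
      (h' _ (min_le_right (-B) (-B'))))
  obtain ⟨B₁, hB₁⟩ := hside ξ hξ
  obtain ⟨B₂, hB₂⟩ := hside η hη
  obtain ⟨B₃, hB₃⟩ := hside ζ hζ
  rcases hB₁ with hB₁ | hB₁ <;> rcases hB₂ with hB₂ | hB₂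
  · exact hpos h₁ _ _ hB₁ hB₂
  · rcases hB₃ with hB₃ | hB₃
    · exact hpos h₂ _ _ hB₁ hB₃
    · exact hneg h₃ _ _ hB₂ hB₃
  · rcases hB₃ with hB₃ | hB₃
    · exact hpos h₃ _ _ hB₂ hB₃
    · exact hneg h₂ _ _ hB₁ hB₃
  · exact hneg h₁ _ _ hB₁ hB₂

/-- Only finitely many lines of the pattern have ends in each of two disjoint cylinders. -/
theorem finite_lines_between [Finite α] (hW : W.Finite) {n : ℕ} (hn : ξ.vertex n ≠ η.vertex n) :
    {l ∈ lines W | ∃ ξ' η' : Boundary α, ξ'.vertex n = ξ.vertex n ∧ η'.vertex n = η.vertex n ∧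
      IsEndOf ξ' l ∧ IsEndOf η' l}.Finite := by
  rcases n with _ | n
  · exact absurd rfl hn
  refine (hW.biUnion fun w _ => (finite_ball (ξ.vertex n) ((cayleyTree α).dist 1 w)).image
    fun z => Set.range fun k : ℤ => z * w ^ k).subset ?_
  rintro - ⟨⟨w, hw, g, rfl⟩, ξ', η', hξ, hη, h1, h2⟩
  obtain ⟨-, ⟨i, rfl⟩, hi⟩ := h1 (n + 1)
  obtain ⟨-, ⟨j, rfl⟩, hj⟩ := h2 (n + 1)
  rw [hξ] at hi
  rw [hη] at hj
  have hj' : g * w ^ j ∉ cone (ξ.vertex n) (ξ.vertex (n + 1)) := fun h =>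
    hn (Boundary.vertex_eq_of_onSegment (Boundary.mem_cone_vertex.1 h) hj)
  obtain ⟨k, -, -, hk⟩ := exists_dist_le_of_cone (ξ.adj_vertex n)
    (Boundary.mem_cone_vertex.2 hi) hj'
  refine Set.mem_biUnion hw ⟨_, hk, (range_eq_of_mem ⟨k, rfl⟩).symm⟩

end Ends

end LinePattern

namespace LinePattern

/-! ### The decomposition space is a closed quotient, hence normal -/

section Quotient

variable {α : Type u} {W : Set (FreeGroup α)}

theorem isQuotientMap_proj : Topology.IsQuotientMap (proj W) :=
  isQuotientMap_quot_mk

variable [Finite α]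

/-- `SameLine` is symmetric, and transitive because lines with a common end have the same ends. The
equivalence relation that it generates therefore only adds the diagonal. -/
theorem proj_eq_iff {ξ η : Boundary α} :
    proj W ξ = proj W η ↔ ξ = η ∨ SameLine W ξ η := by
  constructor
  · intro h
    have h' := Quot.eqvGen_exact h
    clear h
    induction h' with
    | rel x y h => exact Or.inr h
    | refl x => exact Or.inl rfl
    | symm x y h ih =>
      rcases ih with rfl | ⟨l, hl, h1, h2⟩
      · exact Or.inl rfl
      · exact Or.inr ⟨l, hl, h2, h1⟩
    | trans x y z h1 h2 ih1 ih2 =>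
      rcases ih1 with rfl | ⟨l, hl, hx, hy⟩
      · exact ih2
      rcases ih2 with rfl | ⟨l', hl', hy', hz⟩
      · exact Or.inr ⟨l, hl, hx, hy⟩
      · exact Or.inr ⟨l', hl', hy.of_common hl hl' hy' hx, hz⟩
  · rintro (rfl | h)
    · rfl
    · exact Quot.sound h

/-- Points of the decomposition space have at most two preimages. -/
theorem eq_of_proj_eq {ξ η ζ : Boundary α} (h1 : proj W ξ = proj W η) (h2 : proj W ξ = proj W ζ) :
    ξ = η ∨ ξ = ζ ∨ η = ζ := by
  rcases proj_eq_iff.1 h1 with h1 | ⟨l, hl, hξ, hη⟩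
  · exact Or.inl h1
  rcases proj_eq_iff.1 h2 with h2 | ⟨l', hl', hξ', hζ⟩
  · exact Or.inr (Or.inl h2)
  · exact IsEndOf.eq_of_three hl hξ hη (hξ'.of_common hl' hl hξ hζ)

/-- Around a pair with distinct images take the product of two disjoint cylinders. Only finitely
many lines join them, and each contributes a closed set of pairs of ends, which can be removed. -/
theorem isClosed_setOf_proj_eq (hW : W.Finite) :
    IsClosed {p : Boundary α × Boundary α | proj W p.1 = proj W p.2} := by
  rw [← isOpen_compl_iff, isOpen_iff_forall_mem_open]
  rintro ⟨ξ, η⟩ hne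
  replace hne : proj W ξ ≠ proj W η := hne
  obtain ⟨n, hn⟩ := Boundary.exists_vertex_ne (fun h => hne (congrArg (proj W) h))
  set L := {l ∈ lines W | ∃ ξ' η' : Boundary α, ξ'.vertex n = ξ.vertex n ∧
    η'.vertex n = η.vertex n ∧ IsEndOf ξ' l ∧ IsEndOf η' l}
  have hL : L.Finite := finite_lines_between hW hn
  have hC : IsClosed (⋃ l ∈ L, {ξ' : Boundary α | IsEndOf ξ' l} ×ˢ {η' | IsEndOf η' l}) :=
    hL.isClosed_biUnion fun l _ => (isClosed_setOf_isEndOf l).prod (isClosed_setOf_isEndOf l)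
  refine ⟨({ξ' : Boundary α | ξ'.vertex n = ξ.vertex n} ×ˢ {η' | η'.vertex n = η.vertex n}) ∩
    (⋃ l ∈ L, {ξ' : Boundary α | IsEndOf ξ' l} ×ˢ {η' | IsEndOf η' l})ᶜ, ?_,
    ((Boundary.isOpen_setOf_vertex n (· = ξ.vertex n)).prod
      (Boundary.isOpen_setOf_vertex n (· = η.vertex n))).inter hC.isOpen_compl, ⟨rfl, rfl⟩, ?_⟩
  · rintro ⟨ξ', η'⟩ ⟨⟨h1, h2⟩, h3⟩ h4
    replace h1 : ξ'.vertex n = ξ.vertex n := h1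
    replace h2 : η'.vertex n = η.vertex n := h2
    rcases proj_eq_iff.1 (show proj W ξ' = proj W η' from h4) with rfl | ⟨l, hl, h5, h6⟩
    · exact hn (h1.symm.trans h2)
    · exact h3 (Set.mem_biUnion (⟨hl, ξ', η', h1, h2, h5, h6⟩ : l ∈ L) ⟨h5, h6⟩)
  · intro h
    obtain ⟨l, hl, h1, h2⟩ := Set.mem_iUnion₂.1 h
    exact hne (proj_eq_iff.2 (Or.inr ⟨l, hl.1, h1, h2⟩))

/-- The saturation of a closed set is the projection of a closed subset of the relation along a
compact factor. -/
theorem isClosedMap_proj (hW : W.Finite) : IsClosedMap (proj W) := by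
  intro C hC
  rw [← isQuotientMap_proj.isClosed_preimage]
  have h := isClosedMap_snd_of_compactSpace _
    ((isClosed_setOf_proj_eq hW).inter (hC.preimage continuous_fst))
  convert! h using 1
  ext η
  constructor
  · rintro ⟨ξ, hξ, h⟩
    exact ⟨(ξ, η), ⟨h, hξ⟩, rfl⟩
  · rintro ⟨⟨ξ, η'⟩, ⟨h, hξ⟩, rfl⟩
    exact ⟨ξ, hξ, h⟩

/-- For U open, the complement of the image of Uᶜ is open and consists of the points whose whole
fibre lies in U. Applied to separating neighbourhoods upstairs, this separates downstairs. -/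
theorem _root_.IsClosedMap.normalSpace {X Y : Type*} [TopologicalSpace X] [TopologicalSpace Y]
    [NormalSpace X] {f : X → Y} (hf : IsClosedMap f) (hc : Continuous f)
    (hs : Function.Surjective f) : NormalSpace Y where
  normal s t hs' ht' hst := by
    obtain ⟨U, V, hU, hV, hsU, htV, hUV⟩ := normal_separation (hs'.preimage hc) (ht'.preimage hc)
      (hst.preimage f)
    refine ⟨(f '' Uᶜ)ᶜ, (f '' Vᶜ)ᶜ, (hf _ hU.isClosed_compl).isOpen_compl,
      (hf _ hV.isClosed_compl).isOpen_compl, ?_, ?_, ?_⟩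
    · rintro - hy ⟨x, hx, rfl⟩
      exact hx (hsU hy)
    · rintro - hy ⟨x, hx, rfl⟩
      exact hx (htV hy)
    · rw [Set.disjoint_left]
      intro y h1 h2
      obtain ⟨x, rfl⟩ := hs y
      have hxU : x ∈ U := by_contra fun h => h1 ⟨x, h, rfl⟩
      have hxV : x ∈ V := by_contra fun h => h2 ⟨x, h, rfl⟩
      exact Set.disjoint_left.1 hUV hxU hxV

theorem normalSpace_decompositionSpace (hW : W.Finite) : NormalSpace (DecompositionSpace W) :=
  (isClosedMap_proj hW).normalSpace isQuotientMap_proj.continuous isQuotientMap_proj.surjective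

end Quotient

/-! ### Shadows of the vertices adjacent to a subtree -/

section Shadow

variable {α : Type u} {X X' : FiniteSubtree α} {p a x y : FreeGroup α} {ξ : Boundary α}

/-- A path inside X that starts at p could enter the cone only through a, which is not in X. -/
theorem FiniteSubtree.notMem_cone (X : FiniteSubtree α) (hp : p ∈ X.1) (ha : a ∉ X.1)
    (h : (cayleyTree α).Adj p a) (hx : x ∈ X.1) : x ∉ cone p a := by
  have hr := (SimpleGraph.reachable_iff_reflTransGen _ _).1 (X.2 ⟨p, hp⟩ ⟨x, hx⟩)
  suffices ∀ y : (X.1 : Set (FreeGroup α)), Relation.ReflTransGen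
      ((cayleyTree α).induce (X.1 : Set (FreeGroup α))).Adj ⟨p, hp⟩ y → y.1 ∉ cone p a from
    this _ hr
  intro y hy
  induction hy with
  | refl => exact notMem_cone_left p a
  | @tail y z _ hyz ih =>
    intro hz
    have := eq_of_cone_crossing h (SimpleGraph.Adj.symm hyz) hz ih
    exact ha (this.1 ▸ z.2)

/-- A ray changes sides only along the edge between p and a, whose ends are at distance at most |p|
+ 1 from the identity. From depth |p| + 2 on it stays on one side, so membership in a shadow is
decided by a single vertex of the ray. -/
theorem Boundary.vertex_mem_cone_iff (ξ : Boundary α) (h : (cayleyTree α).Adj p a) {n : ℕ}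
    (hn : (cayleyTree α).dist 1 p + 2 ≤ n) :
    ξ.vertex n ∈ cone p a ↔ ξ.vertex ((cayleyTree α).dist 1 p + 2) ∈ cone p a := by
  induction n, hn using Nat.le_induction with
  | base => rfl
  | succ n hn ih =>
    rw [← ih]
    have h1 := dist_of_adj h 1
    rw [SimpleGraph.dist_comm (u := p), SimpleGraph.dist_comm (u := a)] at h1
    constructor
    · intro h2
      by_contra h3
      have := congrArg ((cayleyTree α).dist 1) (eq_of_cone_crossing h (ξ.adj_vertex n).symm h2 h3).2
      rw [dist_one_vertex] at this
      lia
    · intro h2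
      by_contra h3
      have := congrArg ((cayleyTree α).dist 1) (eq_of_cone_crossing h (ξ.adj_vertex n) h2 h3).1
      rw [dist_one_vertex] at this
      lia

theorem mem_shadow_iff (hp : p ∈ X.1) (ha : a ∉ X.1) (h : (cayleyTree α).Adj p a) :
    ξ ∈ shadow X a ↔ ξ.vertex ((cayleyTree α).dist 1 p + 2) ∈ cone p a := by
  constructor
  · intro hξ
    obtain ⟨n, hn, hn'⟩ := ((hξ p hp).and (Filter.eventually_ge_atTop
      ((cayleyTree α).dist 1 p + 2))).exists
    rw [← ξ.vertex_mem_cone_iff h hn']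
    exact (mem_cone_iff_onSegment h).2 hn
  · intro hξ x hx
    filter_upwards [Filter.eventually_ge_atTop ((cayleyTree α).dist 1 p + 2)] with n hn
    rw [← ξ.vertex_mem_cone_iff h hn] at hξ
    exact onSegment_of_mem_cone h (X.notMem_cone hp ha h hx) hξ

theorem shadow_of_eq_empty (hX : X.1 = ∅) (a : FreeGroup α) : shadow X a = Set.univ := by
  ext ξ
  simp [shadow, hX]

theorem isClosed_shadow (a : WhVertex X) : IsClosed (shadow X a.1) := by
  rcases a with ⟨a, ⟨ha, p, hp, h⟩ | ⟨hX, -⟩⟩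
  · have : shadow X a = {ξ | ξ.vertex ((cayleyTree α).dist 1 p + 2) ∈ cone p a} :=
      Set.ext fun ξ => mem_shadow_iff hp ha h
    rw [this]
    exact Boundary.isClosed_setOf_vertex _ (· ∈ cone p a)
  · rw [shadow_of_eq_empty hX]
    exact isClosed_univ

/-- A vertex outside a nonempty subtree is separated from it by a vertex adjacent to it. -/
theorem FiniteSubtree.exists_mem_cone (X : FiniteSubtree α) (hX : X.1.Nonempty) (hy : y ∉ X.1) :
    ∃ p ∈ X.1, ∃ a, a ∉ X.1 ∧ (cayleyTree α).Adj p a ∧ y ∈ cone p a := by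
  obtain ⟨p, hp, hmin⟩ := X.1.exists_min_image (fun x => (cayleyTree α).dist x y) hX
  obtain ⟨a, ha, hya⟩ := exists_adj_mem_cone (p := p) (y := y) (fun h => hy (h ▸ hp))
  refine ⟨p, hp, a, fun h => ?_, ha, hya⟩
  exact absurd (hmin a h) (not_le.2 hya)

theorem exists_mem_shadow (X : FiniteSubtree α) (ξ : Boundary α) :
    ∃ a : WhVertex X, ξ ∈ shadow X a.1 := by
  rcases X.1.eq_empty_or_nonempty with hX | hX
  · exact ⟨⟨1, Or.inr ⟨hX, rfl⟩⟩, by rw [shadow_of_eq_empty hX]; trivial⟩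
  -- N bounds the distance from 1 of every vertex of X, so the vertex N + 2 is outside X and deep
  -- enough to decide membership in each shadow.
  · set N := ∑ x ∈ X.1, (cayleyTree α).dist 1 x
    have hN : ∀ x ∈ X.1, (cayleyTree α).dist 1 x ≤ N := fun x hx =>
      Finset.single_le_sum (f := fun x => (cayleyTree α).dist 1 x) (fun _ _ => Nat.zero_le _) hx
    have hy : ξ.vertex (N + 2) ∉ X.1 := fun h => by
      have := hN _ h
      rw [Boundary.dist_one_vertex] at this
      lia
    obtain ⟨p, hp, a, ha, h, hξ⟩ := X.exists_mem_cone hX hy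
    refine ⟨⟨a, Or.inl ⟨ha, p, hp, h⟩⟩, (mem_shadow_iff hp ha h).2 ?_⟩
    have := hN p hp
    exact (ξ.vertex_mem_cone_iff h (by lia)).1 hξ

/-- Far along the ray to ξ take a vertex y. As a and b lie on the segments from both p and q to y,
and neither belongs to X, comparing lengths forces a to be adjacent to q. Then y lies in the cones
of two neighbours of q. -/
theorem eq_of_mem_shadow {a b : WhVertex X} (ha : ξ ∈ shadow X a.1) (hb : ξ ∈ shadow X b.1) :
    a = b := by
  rcases a with ⟨a, ⟨haX, p, hp, hpa⟩ | ⟨hX, ha1⟩⟩ <;>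
    rcases b with ⟨b, ⟨hbX, q, hq, hqb⟩ | ⟨hX', hb1⟩⟩
  · obtain ⟨n, h⟩ := ((ha p hp).and ((ha q hq).and ((hb p hp).and (hb q hq)))).exists
    generalize ξ.vertex n = y at h
    simp only [OnSegment] at h
    have h1 := (SimpleGraph.dist_eq_one_iff_adj (G := cayleyTree α)).2 hpa
    have h2 := (SimpleGraph.dist_eq_one_iff_adj (G := cayleyTree α)).2 hqb
    have h3 := connected_cayleyTree.pos_dist_of_ne (u := p) (v := b) (fun h => hbX (h ▸ hp))
    have h4 := connected_cayleyTree.pos_dist_of_ne (u := q) (v := a) (fun h => haX (h ▸ hq))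
    have h5 : (cayleyTree α).dist q a = 1 := by lia
    have h6 : (cayleyTree α).Adj q a := SimpleGraph.dist_eq_one_iff_adj.1 h5
    refine Subtype.ext (eq_of_mem_cone (y := y) h6 hqb ?_ ?_)
    · exact (mem_cone_iff_onSegment h6).2 h.2.1
    · exact (mem_cone_iff_onSegment hqb).2 h.2.2.2
  · exact absurd hp (by simp [hX'])
  · exact absurd hq (by simp [hX])
  · exact Subtype.ext (ha1.trans hb1.symm)

/-- The vertex a' lies behind some a adjacent to X, and rays from X that pass through a' pass
through a first. -/
theorem exists_shadow_subset (h : X ≤ X') (a' : WhVertex X') :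
    ∃ a : WhVertex X, shadow X' a'.1 ⊆ shadow X a.1 := by
  rcases X.1.eq_empty_or_nonempty with hX | hX
  · exact ⟨⟨1, Or.inr ⟨hX, rfl⟩⟩, by rw [shadow_of_eq_empty hX]; exact Set.subset_univ _⟩
  · have h' : X.1 ⊆ X'.1 := h
    have ha' : a'.1 ∉ X'.1 := by
      rcases a'.2 with h1 | h1
      · exact h1.1
      · simp [h1.1]
    obtain ⟨p, hp, a, ha, hpa, hmem⟩ := X.exists_mem_cone hX (fun h1 => ha' (h' h1))
    refine ⟨⟨a, Or.inl ⟨ha, p, hp, hpa⟩⟩, fun ξ hξ => (mem_shadow_iff hp ha hpa).2 ?_⟩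
    obtain ⟨n, hn, hn'⟩ := ((hξ p (h' hp)).and (Filter.eventually_ge_atTop
      ((cayleyTree α).dist 1 p + 2))).exists
    rw [← ξ.vertex_mem_cone_iff hpa hn', mem_cone_iff_onSegment hpa]
    exact hn.trans ((mem_cone_iff_onSegment hpa).1 hmem)

/-- The ray with constant letter `s` eventually lies behind an edge labelled `s`. -/
theorem shadow_nonempty (hX : X.1.Nonempty) (a : WhVertex X) : (shadow X a.1).Nonempty := by
  classical
  rcases a with ⟨a, ⟨ha, p, hp, h⟩ | ⟨hX', -⟩⟩
  swap
  · exact absurd hX' hX.ne_empty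
  obtain ⟨s, hs⟩ := cayleyTree_adj.1 h
  by_cases h1 : (1 : FreeGroup α) ∈ cone p a
  · refine ⟨⟨fun _ => s, fun _ _ => rfl⟩, (mem_shadow_iff hp ha h).2 ?_⟩
    set ξ : Boundary α := ⟨fun _ => s, fun _ _ => rfl⟩
    -- Otherwise p is on the ray, so its word is a prefix of a power of s; but here the edge leads
    -- from p towards the identity, so this word ends in the inverse of s.
    by_contra h2
    have h3 := dist_of_cone_separates h h1 h2
    have h4 := dist_of_mem_cone h h1
    rw [SimpleGraph.dist_comm (u := p), SimpleGraph.dist_comm (u := a)] at h4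
    set N := (cayleyTree α).dist 1 p + 2
    have h5 : OnSegment 1 (ξ.vertex N) p := by
      rw [OnSegment]
      lia
    have h6 : (p * FreeGroup.mk [s]).norm < p.norm := by
      rw [← hs]
      simpa [dist_eq_norm] using h4.symm.le
    obtain ⟨L, hL⟩ := norm_mul_letter_lt.1 h6
    simp only [OnSegment, dist_eq_norm, inv_one, one_mul, norm_add_norm_eq_iff, hL,
      Boundary.toWord_vertex] at h5
    have h7 : (s.1, !s.2) ∈ List.ofFn fun i : Fin N => ξ.1 i := h5.subset (by simp)
    obtain ⟨i, hi⟩ := (List.mem_ofFn' _ _).1 h7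
    have h8 : s.2 = !s.2 := congrArg Prod.snd hi
    simp at h8
  · have h2 := dist_of_notMem_cone h h1
    rw [SimpleGraph.dist_comm (u := p), SimpleGraph.dist_comm (u := a)] at h2
    have h3 : (a * FreeGroup.mk [(s.1, !s.2)]).norm < a.norm := by
      rw [← mk_singleton_inv, hs, mul_inv_cancel_right, ← hs]
      simpa [dist_eq_norm] using h2.symm.le
    obtain ⟨L, hL⟩ := norm_mul_letter_lt.1 h3
    replace hL : a.toWord = L ++ [s] := by rw [hL, Bool.not_not]
    have hred := FreeGroup.isReduced_toWord (x := a)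
    rw [hL, FreeGroup.IsReduced, List.isChain_iff_getElem] at hred
    have hgt : ∀ i, L.length ≤ i → (L ++ [s]).getD i s = s := by
      intro i hi
      rcases hi.eq_or_lt with rfl | hi
      · simp
      · exact List.getD_eq_default _ _ (by simpa using hi)
    -- Here the word of a ends in s. The default value s of `getD` continues it by the constant
    -- letter s, so no cancellation arises.
    set ξ : Boundary α := ⟨fun i => (L ++ [s]).getD i s, fun i => by
      beta_reduce
      by_cases hi : i < L.length
      · have := hred i (by simpa using hi)
        rw [List.getD_eq_getElem _ _ (by simp; lia), List.getD_eq_getElem _ _ (by simp; lia)]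
        exact this
      · rw [hgt i (by lia), hgt (i + 1) (by lia)]
        exact fun _ => rfl⟩ with hξ
    have hv : ξ.vertex ((cayleyTree α).dist 1 a) = a := by
      rw [← FreeGroup.toWord_inj, Boundary.toWord_vertex, hL]
      have hlen : (cayleyTree α).dist 1 a = (L ++ [s]).length := by
        simp [dist_eq_norm, FreeGroup.norm, hL]
      rw [hlen]
      refine List.ext_getElem (by simp) fun i hi hi' => ?_
      simp only [List.getElem_ofFn, hξ]
      exact List.getD_eq_getElem _ _ hi'
    refine ⟨ξ, (mem_shadow_iff hp ha h).2 ?_⟩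
    have h4 := ξ.onSegment_vertex (m := (cayleyTree α).dist 1 a) (n := (cayleyTree α).dist 1 p + 2)
      (by lia)
    have h5 := connected_cayleyTree.dist_triangle (u := 1) (v := p)
      (w := ξ.vertex ((cayleyTree α).dist 1 p + 2))
    rw [hv, OnSegment] at h4
    rw [Boundary.dist_one_vertex] at h4 h5
    change (cayleyTree α).dist _ _ < (cayleyTree α).dist _ _
    lia

end Shadow

end LinePattern

/-! ### Swelling finite closed families in normal spaces -/

/-- A finite family of closed sets with empty intersection in a normal space can be enlarged to a
family of open sets with empty intersection. -/
theorem exists_isOpen_iInter_eq_empty {Y ι : Type*} [TopologicalSpace Y] [NormalSpace Y] [Finite ι]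
    {F : ι → Set Y} (hF : ∀ i, IsClosed (F i)) (h : ⋂ i, F i = ∅) :
    ∃ U : ι → Set Y, (∀ i, IsOpen (U i)) ∧ (∀ i, F i ⊆ U i) ∧ ⋂ i, U i = ∅ := by
  -- This is the shrinking lemma for the open cover by the complements of the F i; the complements
  -- of the closures of its members are the required open sets.
  obtain ⟨v, hv, -, hvF⟩ := exists_iUnion_eq_closure_subset (fun i => (hF i).isOpen_compl)
    (fun _ => Set.toFinite _) (by rw [← Set.compl_iInter, h, Set.compl_empty])
  refine ⟨fun i => (closure (v i))ᶜ, fun i => isClosed_closure.isOpen_compl,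
    fun i => Set.subset_compl_comm.1 (hvF i), ?_⟩
  rw [← Set.compl_iUnion, Set.compl_empty_iff, ← Set.univ_subset_iff, ← hv]
  exact Set.iUnion_mono fun i => subset_closure

/-- A finite family of closed sets in a normal space can be swelled to a family of open sets with
the same nerve. -/
theorem exists_swelling {Y ι : Type*} [TopologicalSpace Y] [NormalSpace Y] [Finite ι]
    {F : ι → Set Y} (hF : ∀ i, IsClosed (F i)) :
    ∃ U : ι → Set Y, (∀ i, IsOpen (U i)) ∧ (∀ i, F i ⊆ U i) ∧
      ∀ J : Set ι, ⋂ i ∈ J, F i = ∅ → ⋂ i ∈ J, U i = ∅ := by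
  classical
  have h : ∀ J : Set ι, ∃ U : ι → Set Y, (∀ i, IsOpen (U i)) ∧ (∀ i, F i ⊆ U i) ∧
      (⋂ i ∈ J, F i = ∅ → ⋂ i ∈ J, U i = ∅) := by
    intro J
    by_cases hJ : ⋂ i ∈ J, F i = ∅
    · obtain ⟨U, hU, hFU, hUe⟩ := exists_isOpen_iInter_eq_empty (F := fun i : J => F i)
        (fun i => hF i) (by rw [← hJ, Set.biInter_eq_iInter])
      refine ⟨fun i => if hi : i ∈ J then U ⟨i, hi⟩ else Set.univ, fun i => ?_, fun i => ?_,
        fun _ => ?_⟩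
      · dsimp only; split_ifs
        exacts [hU _, isOpen_univ]
      · dsimp only; split_ifs with hi
        exacts [hFU ⟨i, hi⟩, Set.subset_univ _]
      · rw [← hUe, Set.biInter_eq_iInter]
        exact Set.iInter_congr fun i => dif_pos i.2
    · exact ⟨fun _ => Set.univ, fun _ => isOpen_univ, fun _ => Set.subset_univ _,
        fun h => absurd h hJ⟩
  choose U hU hFU hUe using h
  -- There are finitely many index sets J, so the enlargements that work for each J separately can
  -- be intersected.
  refine ⟨fun i => ⋂ J, U J i, fun i => isOpen_iInter_of_finite fun J => hU J i,
    fun i => Set.subset_iInter fun J => hFU J i, fun J hJ => ?_⟩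
  rw [← Set.subset_empty_iff, ← hUe J hJ]
  exact Set.iInter₂_mono fun i _ => Set.iInter_subset _ J

namespace LinePattern
open Cech

/-! ### Associated covers: existence, compatibility, cofinality, nerve -/

section Covers

variable {α : Type u} {W : Set (FreeGroup α)} {X X' : FiniteSubtree α}

/-- Distinct shadows are disjoint, so a common point of their images can only come from identifying
the ends of a line. -/
theorem proj_shadow_inter_nonempty_iff [Finite α] {a b : WhVertex X} (hab : a ≠ b) :
    (proj W '' shadow X a.1 ∩ proj W '' shadow X b.1).Nonempty ↔ (whiteheadGraph W X).Adj a b := by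
  constructor
  · rintro ⟨-, ⟨ξ, hξ, rfl⟩, η, hη, h⟩
    rcases proj_eq_iff.1 h.symm with rfl | ⟨l, hl, h1, h2⟩
    · exact absurd (eq_of_mem_shadow hξ hη) hab
    · exact ⟨hab, l, hl, ξ, hξ, η, hη, h1, h2⟩
  · rintro ⟨-, l, hl, ξ, hξ, η, hη, h1, h2⟩
    exact ⟨_, ⟨ξ, hξ, rfl⟩, η, hη, Quot.sound ⟨l, hl, h2, h1⟩⟩

/-- A common point would have preimages in three disjoint shadows, while fibres have at most two
points. -/
theorem proj_shadow_no_triple [Finite α] {a b c : WhVertex X} (hab : a ≠ b) (hac : a ≠ c)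
    (hbc : b ≠ c) :
    proj W '' shadow X a.1 ∩ proj W '' shadow X b.1 ∩ proj W '' shadow X c.1 = ∅ := by
  rw [Set.eq_empty_iff_forall_notMem]
  rintro - ⟨⟨⟨ξ, hξ, rfl⟩, η, hη, h1⟩, ζ, hζ, h2⟩
  rcases eq_of_proj_eq h1.symm h2.symm with rfl | rfl | rfl
  · exact hab (eq_of_mem_shadow hξ hη)
  · exact hac (eq_of_mem_shadow hξ hζ)
  · exact hbc (eq_of_mem_shadow hη hζ)

instance [Finite α] : Finite (WhVertex X) := by
  have h : (⋃ x ∈ X.1, {y | (cayleyTree α).dist x y ≤ 1} ∪ {1}).Finite :=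
    X.1.finite_toSet.biUnion fun x _ => (finite_ball x 1).union (Set.finite_singleton 1)
  have h' := h.union (Set.finite_singleton (1 : FreeGroup α))
  refine (h'.subset (fun a ha => ?_) : {a : FreeGroup α | (a ∉ X.1 ∧ ∃ x ∈ X.1,
    (cayleyTree α).Adj x a) ∨ (X.1 = ∅ ∧ a = 1)}.Finite).to_subtype
  rcases ha with ⟨-, x, hx, hxa⟩ | ⟨-, rfl⟩
  · exact Or.inl (Set.mem_biUnion hx (Or.inl (SimpleGraph.dist_eq_one_iff_adj.2 hxa).le))
  · exact Or.inr rfl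

theorem isOpenCover_of_shadow_subset {U : WhVertex X → Opens (DecompositionSpace W)}
    (hU : ∀ a, proj W '' shadow X a.1 ⊆ U a) : IsOpenCover U := by
  refine IsOpenCover.mk (Opens.ext ?_)
  rw [Opens.coe_iSup, Opens.coe_top, Set.eq_univ_iff_forall]
  intro y
  obtain ⟨ξ, rfl⟩ := isQuotientMap_proj.surjective y
  obtain ⟨a, ha⟩ := exists_mem_shadow X ξ
  exact Set.mem_iUnion.2 ⟨a, hU a ⟨ξ, ha, rfl⟩⟩

/-- Shrinking the members of an associated cover, as long as they contain the shadows. -/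
def WhCover.shrink (𝒰 : WhCover W X) (V : WhVertex X → Opens (DecompositionSpace W))
    (hV : ∀ a, proj W '' shadow X a.1 ⊆ V a) : WhCover W X where
  U a := 𝒰.U a ⊓ V a
  isOpenCover := isOpenCover_of_shadow_subset fun a =>
    Set.subset_inter (𝒰.shadow_subset a) (hV a)
  shadow_subset a := Set.subset_inter (𝒰.shadow_subset a) (hV a)
  inter_nonempty_iff a b hab := by
    constructor
    · rintro ⟨y, h1, h2⟩
      exact (𝒰.inter_nonempty_iff a b hab).1 ⟨y, h1.1, h2.1⟩
    · rintro ⟨-, l, hl, ξ, hξ, η, hη, h1, h2⟩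
      have h3 : proj W ξ = proj W η := Quot.sound ⟨l, hl, h1, h2⟩
      refine ⟨proj W ξ, ⟨𝒰.shadow_subset a ⟨ξ, hξ, rfl⟩, hV a ⟨ξ, hξ, rfl⟩⟩, ?_⟩
      rw [h3]
      exact ⟨𝒰.shadow_subset b ⟨η, hη, rfl⟩, hV b ⟨η, hη, rfl⟩⟩
  no_triple a b c hab hac hbc := by
    rw [Set.eq_empty_iff_forall_notMem]
    rintro y ⟨⟨h1, h2⟩, h3⟩
    exact Set.eq_empty_iff_forall_notMem.1 (𝒰.no_triple a b c hab hac hbc) y ⟨⟨h1.1, h2.1⟩, h3.1⟩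

theorem isClosed_proj_shadow [Finite α] (hW : W.Finite) (a : WhVertex X) :
    IsClosed (proj W '' shadow X a.1) :=
  isClosedMap_proj hW _ (isClosed_shadow a)

theorem nonempty_whCover [Finite α] (hW : W.Finite) (X : FiniteSubtree α) :
    Nonempty (WhCover W X) := by
  have := normalSpace_decompositionSpace hW
  obtain ⟨U, hU, hFU, hJ⟩ := exists_swelling (isClosed_proj_shadow (X := X) hW)
  refine ⟨⟨fun a => ⟨U a, hU a⟩, isOpenCover_of_shadow_subset hFU, hFU, fun a b hab => ?_,
    fun a b c hab hac hbc => ?_⟩⟩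
  · rw [← proj_shadow_inter_nonempty_iff hab]
    refine ⟨fun h => ?_, Set.Nonempty.mono (Set.inter_subset_inter (hFU a) (hFU b))⟩
    rw [Set.nonempty_iff_ne_empty] at h ⊢
    exact fun h' => h (by simpa using hJ {a, b} (by simpa using h'))
  · have := hJ {a, b, c} (by simpa [Set.inter_assoc] using proj_shadow_no_triple hab hac hbc)
    simpa [Set.inter_assoc] using this

theorem WhCover.exists_refinement [Finite α] (hW : W.Finite) (h : X ≤ X') (𝒰 : WhCover W X) :
    ∃ 𝒰' : WhCover W X', 𝒰.cover ≤ 𝒰'.cover := by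
  obtain ⟨𝒱⟩ := nonempty_whCover hW X'
  choose ρ hρ using exists_shadow_subset h
  exact ⟨𝒱.shrink (fun a => 𝒰.U (ρ a)) fun a =>
    (Set.image_mono (hρ a)).trans (𝒰.shadow_subset _), ρ, fun a => inf_le_right⟩

theorem finite_setOf_le (X' : FiniteSubtree α) : Finite {X : FiniteSubtree α // X ≤ X'} :=
  Finite.of_injective (β := X'.1.powerset)
    (fun X => ⟨X.1.1, Finset.mem_powerset.2 X.2⟩)
    fun _ _ h => Subtype.ext (Subtype.ext (congrArg (fun Z => Z.1) h))

/-- Associated covers can be chosen compatibly. -/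
theorem exists_monotone_whCover [Finite α] (hW : W.Finite) :
    ∃ 𝒰 : ∀ X : FiniteSubtree α, WhCover W X, Monotone fun X => (𝒰 X).cover := by
  let 𝒱 := fun X : FiniteSubtree α => (nonempty_whCover (W := W) hW X).some
  have hfin := fun X' : FiniteSubtree α => finite_setOf_le X'
  -- Each member is cut down by the chosen members for all smaller subtrees whose shadows contain
  -- its own. The constraints at X reappear among those at X' ≥ X, which makes the choice monotone.
  let V : ∀ X' : FiniteSubtree α, WhVertex X' → Opens (DecompositionSpace W) := fun X' a' =>
    ⟨⋂ X : {X // X ≤ X'}, ⋂ a : {a : WhVertex X.1 // shadow X' a'.1 ⊆ shadow X.1 a.1},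
      (𝒱 X.1).U a.1, isOpen_iInter_of_finite fun X => isOpen_iInter_of_finite fun a =>
        ((𝒱 X.1).U a.1).isOpen⟩
  have hV : ∀ X' a', proj W '' shadow X' a'.1 ⊆ V X' a' := fun X' a' =>
    Set.subset_iInter fun X => Set.subset_iInter fun a =>
      (Set.image_mono a.2).trans ((𝒱 X.1).shadow_subset a.1)
  refine ⟨fun X => (𝒱 X).shrink (V X) (hV X), fun X X' h => ?_⟩
  choose ρ hρ using exists_shadow_subset h
  refine ⟨ρ, fun a' => le_trans inf_le_right (fun y hy => ?_)⟩
  have hy' := fun Y b => Set.mem_iInter.1 (Set.mem_iInter.1 hy Y) b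
  exact ⟨hy' ⟨X, h⟩ ⟨ρ a', hρ a'⟩, Set.mem_iInter.2 fun Y => Set.mem_iInter.2 fun b =>
    hy' ⟨Y.1, Y.2.trans h⟩ ⟨b.1, (hρ a').trans b.2⟩⟩

/-- The ball of radius `n` about the identity as a subtree. -/
noncomputable def FiniteSubtree.ball [Finite α] (n : ℕ) : FiniteSubtree α :=
  ⟨(finite_ball (1 : FreeGroup α) n).toFinset, by
    have key : ∀ m, ∀ x : ((finite_ball (1 : FreeGroup α) n).toFinset : Set (FreeGroup α)),
        (cayleyTree α).dist x.1 1 = m →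
        ((cayleyTree α).induce _).Reachable x ⟨1, by simp⟩ := by
      intro m
      induction m with
      | zero =>
        intro x hx
        rw [connected_cayleyTree.dist_eq_zero_iff] at hx
        rw [show x = ⟨1, by simp⟩ from Subtype.ext hx]
      | succ m ih =>
        intro x hx
        have h1 : x.1 ≠ 1 := by
          intro h
          rw [h, SimpleGraph.dist_self] at hx
          lia
        obtain ⟨a, ha, hxa⟩ := exists_adj_mem_cone h1
        have h2 := dist_of_mem_cone ha hxa
        have h3 : (cayleyTree α).dist 1 x.1 ≤ n := by simpa using x.2
        rw [SimpleGraph.dist_comm] at h3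
        have h4 : a ∈ ((finite_ball (1 : FreeGroup α) n).toFinset : Set (FreeGroup α)) := by
          rw [Set.Finite.coe_toFinset]
          change (cayleyTree α).dist 1 a ≤ n
          rw [SimpleGraph.dist_comm]
          lia
        have h5 : ((cayleyTree α).induce _).Adj x ⟨a, h4⟩ := ha
        exact h5.reachable.trans (ih ⟨a, h4⟩ (by dsimp only; lia))
    intro x y
    exact (key _ x rfl).trans (key _ y rfl).symm⟩

theorem FiniteSubtree.mem_ball [Finite α] {n : ℕ} {x : FreeGroup α} :
    x ∈ (FiniteSubtree.ball n : FiniteSubtree α).1 ↔ (cayleyTree α).dist 1 x ≤ n := by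
  simp [FiniteSubtree.ball]

theorem FiniteSubtree.exists_le_ball [Finite α] (X : FiniteSubtree α) :
    ∃ n, ∀ m, n ≤ m → X ≤ FiniteSubtree.ball m := by
  refine ⟨X.1.sup fun x => (cayleyTree α).dist 1 x, fun m hm x hx => FiniteSubtree.mem_ball.2 ?_⟩
  exact (Finset.le_sup (f := fun x => (cayleyTree α).dist 1 x) hx).trans hm

theorem isDirectedOrder_finiteSubtree [Finite α] : IsDirectedOrder (FiniteSubtree α) where
  directed X Y := by
    obtain ⟨m, hm⟩ := X.exists_le_ball
    obtain ⟨n, hn⟩ := Y.exists_le_ball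
    exact ⟨FiniteSubtree.ball (max m n), hm _ (le_max_left _ _), hn _ (le_max_right _ _)⟩

/-- Shadows of large subtrees are small. -/
theorem vertex_eq_of_mem_shadow [Finite α] {n : ℕ} (hX : FiniteSubtree.ball n ≤ X) (a : WhVertex X)
    {ξ η : Boundary α} (hξ : ξ ∈ shadow X a.1) (hη : η ∈ shadow X a.1) :
    ξ.vertex n = η.vertex n := by
  have h1 : (1 : FreeGroup α) ∈ X.1 := hX (FiniteSubtree.mem_ball.2 (by simp))
  have ha : a.1 ∉ X.1 := by
    rcases a.2 with h | h
    · exact h.1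
    · simp [h.1]
  have h2 : n ≤ (cayleyTree α).dist 1 a.1 := by
    by_contra h
    exact ha (hX (FiniteSubtree.mem_ball.2 (by lia)))
  -- Every ray to a point of the shadow passes through a, which is at distance at least n from the
  -- identity; so its first n letters are read off from a.
  have key : ∀ θ ∈ shadow X a.1, OnSegment 1 a.1 (θ.vertex n) := by
    intro θ hθ
    obtain ⟨m, hm, hm'⟩ := ((hθ 1 h1).and (Filter.eventually_ge_atTop
      ((cayleyTree α).dist 1 a.1))).exists
    have h3 : θ.vertex ((cayleyTree α).dist 1 a.1) = a.1 :=
      (θ.onSegment_vertex hm').eq_of_dist_eq hm (θ.dist_one_vertex _)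
    exact h3 ▸ θ.onSegment_vertex h2
  exact Boundary.vertex_eq_of_onSegment (key ξ hξ) (key η hη)

/-- For all large subtrees, the images of the shadows lie in members of a given open cover. -/
theorem exists_proj_shadow_subset [Finite α] {ι : Type*} {V : ι → Set (DecompositionSpace W)}
    (hV : ∀ i, IsOpen (V i)) (hcov : ∀ y, ∃ i, y ∈ V i) :
    ∃ X₀ : FiniteSubtree α, ∀ X, X₀ ≤ X → ∀ a : WhVertex X, ∃ i, ∀ ξ ∈ shadow X a.1,
      proj W ξ ∈ V i := by
  choose i hi using fun ξ : Boundary α => hcov (proj W ξ)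
  choose n hn using fun ξ : Boundary α => Boundary.exists_cylinder_subset
    ((hV (i ξ)).preimage isQuotientMap_proj.continuous) (hi ξ)
  -- A Lebesgue number argument: finitely many cylinders suffice, and a ball of their maximal depth
  -- has shadows each contained in one of them.
  obtain ⟨t, ht⟩ := (isCompact_univ (X := Boundary α)).elim_finite_subcover
    (fun ξ => {η : Boundary α | η.vertex (n ξ) = ξ.vertex (n ξ)})
    (fun ξ => Boundary.isOpen_setOf_vertex (n ξ) (· = ξ.vertex (n ξ)))
    (fun ξ _ => Set.mem_iUnion.2 ⟨ξ, rfl⟩)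
  refine ⟨FiniteSubtree.ball (t.sup n), fun X hX a => ?_⟩
  have hX1 : X.1.Nonempty := ⟨1, hX (FiniteSubtree.mem_ball.2 (by simp))⟩
  obtain ⟨η, hη⟩ := shadow_nonempty hX1 a
  obtain ⟨θ, hθ, hηθ⟩ := Set.mem_iUnion₂.1 (ht (Set.mem_univ η))
  refine ⟨i θ, fun ξ hξ => hn θ ξ ?_⟩
  have h1 := vertex_eq_of_mem_shadow hX a hξ hη
  exact (Boundary.vertex_eq_of_le h1 (Finset.le_sup hθ)).trans hηθ

/-- Every open cover is refined by every cover associated to some sufficiently large subtree. -/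
theorem exists_forall_whCover_refines [Finite α] (hW : W.Finite)
    (𝒪 : OpenCover (DecompositionSpace W)) :
    ∃ X : FiniteSubtree α, ∀ 𝒰 : WhCover W X, 𝒪 ≤ 𝒰.cover := by
  obtain ⟨X₀, hX₀⟩ := exists_proj_shadow_subset (fun i => (𝒪.U i).isOpen)
    fun y => 𝒪.isOpenCover.exists_mem y
  choose σ hσ using hX₀ X₀ le_rfl
  set F : WhVertex X₀ → Set (DecompositionSpace W) := fun a => proj W '' shadow X₀ a.1
  have hF : ∀ a, IsClosed (F a) := isClosed_proj_shadow hW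
  -- The neighbourhood of y avoids every F a that misses y, and lies in the chosen member around
  -- every F a that contains y. So if it meets F a at all, then it lies entirely in 𝒪.U (σ a).
  obtain ⟨X₁, hX₁⟩ := exists_proj_shadow_subset
    (V := fun y : DecompositionSpace W => ⋂ a, {z | (y ∈ F a → z ∈ 𝒪.U (σ a)) ∧ (y ∉ F a → z ∉ F a)})
    (fun y => isOpen_iInter_of_finite fun a => by
      by_cases hy : y ∈ F a
      · simpa [hy] using (𝒪.U (σ a)).isOpen
      · simp only [hy, false_imp_iff, not_false_iff, true_imp_iff, true_and]
        exact (hF a).isOpen_compl)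
    (fun y => ⟨y, Set.mem_iInter.2 fun a => ⟨fun ⟨ξ, hξ, h⟩ => h ▸ hσ a ξ hξ, id⟩⟩)
  obtain ⟨X, h0, h1⟩ := isDirectedOrder_finiteSubtree.directed X₀ X₁
  refine ⟨X, fun 𝒰 => ?_⟩
  choose ρ hρ using exists_shadow_subset h0
  refine ⟨fun a => σ (ρ a), fun a y hy => ?_⟩
  obtain ⟨η, rfl⟩ := isQuotientMap_proj.surjective y
  obtain ⟨b, hb⟩ := exists_mem_shadow X η
  by_cases hab : a = b
  · subst hab
    exact hσ _ η (hρ _ hb)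
  -- A point of U a in the image of another shadow S(b) forces an edge, so the image of S(b) meets
  -- that of S(a), hence F (ρ a). As the image of S(b) lies in one of the neighbourhoods above, all
  -- of it is in 𝒪.U (σ (ρ a)).
  · have h2 : (whiteheadGraph W X).Adj a b :=
      (𝒰.inter_nonempty_iff a b hab).1 ⟨_, hy, 𝒰.shadow_subset b ⟨η, hb, rfl⟩⟩
    obtain ⟨-, ⟨ξ, hξ, rfl⟩, ζ, hζ, h3⟩ := (proj_shadow_inter_nonempty_iff hab).2 h2
    obtain ⟨y, hy⟩ := hX₁ X h1 b
    have h4 := Set.mem_iInter.1 (hy ζ hζ) (ρ a)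
    have h5 := Set.mem_iInter.1 (hy η hb) (ρ a)
    refine h5.1 (by_contra fun h => h4.2 h ?_)
    exact ⟨ξ, hρ a hξ, h3.symm⟩

/-- The nerve of an associated cover is the Whitehead graph. -/
theorem WhCover.meets_iff (hX : X.1.Nonempty) (𝒰 : WhCover W X) {k : ℕ}
    (t : Fin (k + 1) → WhVertex X) : Meets 𝒰.cover t ↔
      ∃ a b, (a = b ∨ (whiteheadGraph W X).Adj a b) ∧ ∀ i, t i = a ∨ t i = b := by
  constructor
  · rintro ⟨y, hy⟩
    replace hy : ∀ i, y ∈ 𝒰.U (t i) := fun i => Set.mem_iInter.1 hy i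
    by_cases h : ∀ i, t i = t 0
    · exact ⟨t 0, t 0, Or.inl rfl, fun i => Or.inl (h i)⟩
    · push Not at h
      obtain ⟨j, hj⟩ := h
      refine ⟨t 0, t j, Or.inr ((𝒰.inter_nonempty_iff _ _ hj.symm).1 ⟨y, hy 0, hy j⟩), fun i => ?_⟩
      by_contra! hi
      exact Set.eq_empty_iff_forall_notMem.1 (𝒰.no_triple _ _ _ hj.symm hi.1.symm hi.2.symm) y
        ⟨⟨hy 0, hy j⟩, hy i⟩
  · rintro ⟨a, b, hab, ht⟩
    obtain ⟨y, hya, hyb⟩ : ((𝒰.U a : Set (DecompositionSpace W)) ∩ 𝒰.U b).Nonempty := by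
      rcases hab with rfl | hab
      · obtain ⟨ξ, hξ⟩ := shadow_nonempty hX a
        exact ⟨_, 𝒰.shadow_subset a ⟨ξ, hξ, rfl⟩, 𝒰.shadow_subset a ⟨ξ, hξ, rfl⟩⟩
      · exact (𝒰.inter_nonempty_iff a b hab.1).2 hab
    refine ⟨y, Set.mem_iInter.2 fun i => ?_⟩
    rcases ht i with h | h <;> rw [h]
    exacts [hya, hyb]

end Covers

end LinePattern

/-! ### Čech cohomology: refinement functions and limits over cofinal families -/

namespace Cech

variable {Y : Type u} [TopologicalSpace Y] {𝒰 𝒱 : OpenCover Y}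

instance : IsDirectedOrder (OpenCover Y) where
  directed 𝒰 𝒱 := by
    refine ⟨⟨𝒰.ι × 𝒱.ι, fun p => 𝒰.U p.1 ⊓ 𝒱.U p.2, IsOpenCover.mk (Opens.ext ?_)⟩,
      ⟨Prod.fst, fun p => inf_le_left⟩, ⟨Prod.snd, fun p => inf_le_right⟩⟩
    rw [Opens.coe_iSup, Opens.coe_top, Set.eq_univ_iff_forall]
    intro y
    obtain ⟨i, hi⟩ := 𝒰.isOpenCover.exists_mem y
    obtain ⟨j, hj⟩ := 𝒱.isOpenCover.exists_mem y
    exact Set.mem_iUnion.2 ⟨(i, j), hi, hj⟩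

instance : Nonempty (OpenCover Y) :=
  ⟨⟨PUnit, fun _ => ⊤, IsOpenCover.mk (by simp)⟩⟩

/-- An alternating cochain vanishes on degenerate simplices. -/
theorem Cochain.apply_eq_zero {n : ℕ} (f : Cochain 𝒰 n) (t : Simplex 𝒰 n) {i j : Fin (n + 1)}
    (hij : i ≠ j) (h : t.1 i = t.1 j) : f.1 t = 0 := by
  have h1 : t.reindex (Equiv.swap i j) = t := by
    refine Subtype.ext (funext fun k => ?_)
    change t.1 (Equiv.swap i j k) = t.1 k
    rcases eq_or_ne k i with rfl | hi
    · rw [Equiv.swap_apply_left, h]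
    rcases eq_or_ne k j with rfl | hj
    · rw [Equiv.swap_apply_right, h]
    · rw [Equiv.swap_apply_of_ne_of_ne hi hj]
  have h2 := f.2 t (Equiv.swap i j)
  rw [h1, Equiv.Perm.sign_swap hij] at h2
  push_cast at h2
  linarith

theorem subsingleton_coverCohomology {n : ℕ} (h : ∀ f : Cochain 𝒰 n, f = 0) :
    Subsingleton (CoverCohomology 𝒰 n) := by
  have : Subsingleton (Cocycle 𝒰 n) := ⟨fun f g => Subtype.ext ((h f.1).trans (h g.1).symm)⟩
  exact (Submodule.Quotient.mk_surjective _).subsingleton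

theorem refineMap_mk {ρ : 𝒱.ι → 𝒰.ι} (hρ : IsRefinement 𝒰 𝒱 ρ) (n : ℕ) (f : Cocycle 𝒰 n) :
    refineMap hρ n (Submodule.Quotient.mk f) = Submodule.Quotient.mk (pullbackCocycle hρ n f) :=
  rfl

theorem refineMap_eq_of_sub_mem {ρ σ : 𝒱.ι → 𝒰.ι} (hρ : IsRefinement 𝒰 𝒱 ρ)
    (hσ : IsRefinement 𝒰 𝒱 σ) {n : ℕ}
    (h : ∀ f ∈ Cocycle 𝒰 n, pullback hρ n f - pullback hσ n f ∈ Coboundary 𝒱 n) :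
    refineMap hρ n = refineMap hσ n := by
  ext x
  obtain ⟨f, rfl⟩ := Submodule.Quotient.mk_surjective _ x
  rw [refineMap_mk, refineMap_mk]
  exact (Submodule.Quotient.eq _).2 (h f.1 f.2)

theorem Cocycle.apply_zero {f : Cochain 𝒰 0} (hf : f ∈ Cocycle 𝒰 0) {a b : 𝒰.ι}
    (hab : Meets 𝒰 ![a, b]) (ha : Meets 𝒰 ![a]) (hb : Meets 𝒰 ![b]) :
    f.1 ⟨![a], ha⟩ = f.1 ⟨![b], hb⟩ := by
  have h : (d 𝒰 0 f).1 ⟨![a, b], hab⟩ = 0 := by rw [LinearMap.mem_ker.1 hf]; rfl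
  change ∑ k : Fin 2, (-1 : ℤ) ^ (k : ℕ) * f.1 (Simplex.reindex _ k.succAbove) = 0 at h
  have e0 : Simplex.reindex (⟨![a, b], hab⟩ : Simplex 𝒰 1) (Fin.succAbove 0) = ⟨![b], hb⟩ :=
    Subtype.ext (funext fun i => by fin_cases i; rfl)
  have e1 : Simplex.reindex (⟨![a, b], hab⟩ : Simplex 𝒰 1) (Fin.succAbove 1) = ⟨![a], ha⟩ :=
    Subtype.ext (funext fun i => by fin_cases i; rfl)
  rw [Fin.sum_univ_two, e0, e1, Fin.val_zero, Fin.val_one, pow_zero, pow_one] at h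
  linarith

theorem Cocycle.apply_one {f : Cochain 𝒰 1} (hf : f ∈ Cocycle 𝒰 1) {a b c : 𝒰.ι}
    (h : Meets 𝒰 ![a, b, c]) (hbc : Meets 𝒰 ![b, c]) (hac : Meets 𝒰 ![a, c])
    (hab : Meets 𝒰 ![a, b]) :
    f.1 ⟨![b, c], hbc⟩ - f.1 ⟨![a, c], hac⟩ + f.1 ⟨![a, b], hab⟩ = 0 := by
  have h0 : (d 𝒰 1 f).1 ⟨![a, b, c], h⟩ = 0 := by rw [LinearMap.mem_ker.1 hf]; rfl
  change ∑ k : Fin 3, (-1 : ℤ) ^ (k : ℕ) * f.1 (Simplex.reindex _ k.succAbove) = 0 at h0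
  have e0 : Simplex.reindex (⟨![a, b, c], h⟩ : Simplex 𝒰 2) (Fin.succAbove 0) = ⟨![b, c], hbc⟩ :=
    Subtype.ext (funext fun i => by fin_cases i <;> rfl)
  have e1 : Simplex.reindex (⟨![a, b, c], h⟩ : Simplex 𝒰 2) (Fin.succAbove 1) = ⟨![a, c], hac⟩ :=
    Subtype.ext (funext fun i => by fin_cases i <;> rfl)
  have e2 : Simplex.reindex (⟨![a, b, c], h⟩ : Simplex 𝒰 2) (Fin.succAbove 2) = ⟨![a, b], hab⟩ :=
    Subtype.ext (funext fun i => by fin_cases i <;> rfl)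
  rw [Fin.sum_univ_three, e0, e1, e2, Fin.val_zero, Fin.val_one, Fin.val_two, pow_zero, pow_one,
    neg_one_sq] at h0
  linarith

/-- In degrees `0` and `1` different refinement functions induce the same map. -/
theorem refineMap_eq_of_lt_two {ρ σ : 𝒱.ι → 𝒰.ι} (hρ : IsRefinement 𝒰 𝒱 ρ)
    (hσ : IsRefinement 𝒰 𝒱 σ) {n : ℕ} (hn : n < 2) : refineMap hρ n = refineMap hσ n := by
  refine refineMap_eq_of_sub_mem hρ hσ fun f hf => ?_
  have hvert : ∀ (y : Y) (a : 𝒰.ι), y ∈ 𝒰.U a → Meets 𝒰 ![a] :=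
    fun y a ha => ⟨y, Set.mem_iInter.2 fun i => by fin_cases i; exact ha⟩
  have hedge : ∀ (y : Y) (a b : 𝒰.ι), y ∈ 𝒰.U a → y ∈ 𝒰.U b → Meets 𝒰 ![a, b] :=
    fun y a b ha hb => ⟨y, Set.mem_iInter.2 fun i => by fin_cases i; exacts [ha, hb]⟩
  have htri : ∀ (y : Y) (a b c : 𝒰.ι), y ∈ 𝒰.U a → y ∈ 𝒰.U b → y ∈ 𝒰.U c → Meets 𝒰 ![a, b, c] :=
    fun y a b c ha hb hc =>
      ⟨y, Set.mem_iInter.2 fun i => by fin_cases i; exacts [ha, hb, hc]⟩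
  interval_cases n
  · change pullback hρ 0 f - pullback hσ 0 f = 0
    ext t
    obtain ⟨y, hy⟩ := t.2
    have hy0 := Set.mem_iInter.1 hy 0
    have hρ0 := hρ _ hy0
    have hσ0 := hσ _ hy0
    have e1 : t.map hρ = ⟨![ρ (t.1 0)], hvert y _ hρ0⟩ :=
      Subtype.ext (funext fun i => by fin_cases i; rfl)
    have e2 : t.map hσ = ⟨![σ (t.1 0)], hvert y _ hσ0⟩ :=
      Subtype.ext (funext fun i => by fin_cases i; rfl)
    change f.1 (t.map hρ) - f.1 (t.map hσ) = 0
    rw [e1, e2, sub_eq_zero]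
    exact Cocycle.apply_zero hf (hedge y _ _ hρ0 hσ0) _ _
  · have hv : ∀ s : Simplex 𝒱 0, Meets 𝒰 ![ρ (s.1 0), σ (s.1 0)] := fun s => by
      obtain ⟨y, hy⟩ := s.2
      exact hedge y _ _ (hρ _ (Set.mem_iInter.1 hy 0)) (hσ _ (Set.mem_iInter.1 hy 0))
    -- The prism operator: g evaluates f on the edge from ρ to σ.
    let g : Cochain 𝒱 0 := ⟨fun s => f.1 ⟨_, hv s⟩, by
      intro s τ
      have hτ : τ = 1 := Equiv.ext fun i => Fin.ext (by lia)
      subst hτ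
      rw [Equiv.Perm.sign_one, Units.val_one, one_mul]
      rfl⟩
    refine ⟨-g, ?_⟩
    rw [map_neg]
    ext t
    obtain ⟨y, hy⟩ := t.2
    have hρ0 := hρ _ (Set.mem_iInter.1 hy 0)
    have hσ0 := hσ _ (Set.mem_iInter.1 hy 0)
    have hρ1 := hρ _ (Set.mem_iInter.1 hy 1)
    have hσ1 := hσ _ (Set.mem_iInter.1 hy 1)
    -- The triangles (ρ0, ρ1, σ1) and (ρ0, σ0, σ1) fill the square between the two images of the
    -- edge. Subtracting their cocycle relations removes the diagonal and leaves minus the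
    -- differential of g.
    have h1 := Cocycle.apply_one hf (htri y _ _ _ hρ0 hρ1 hσ1) (hedge y _ _ hρ1 hσ1)
      (hedge y _ _ hρ0 hσ1) (hedge y _ _ hρ0 hρ1)
    have h2 := Cocycle.apply_one hf (htri y _ _ _ hρ0 hσ0 hσ1) (hedge y _ _ hσ0 hσ1)
      (hedge y _ _ hρ0 hσ1) (hedge y _ _ hρ0 hσ0)
    have e1 : t.map hρ = ⟨![ρ (t.1 0), ρ (t.1 1)], hedge y _ _ hρ0 hρ1⟩ :=
      Subtype.ext (funext fun i => by fin_cases i <;> rfl)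
    have e2 : t.map hσ = ⟨![σ (t.1 0), σ (t.1 1)], hedge y _ _ hσ0 hσ1⟩ :=
      Subtype.ext (funext fun i => by fin_cases i <;> rfl)
    have e3 : g.1 (t.reindex (Fin.succAbove 0)) =
      f.1 ⟨![ρ (t.1 1), σ (t.1 1)], hedge y _ _ hρ1 hσ1⟩ := rfl
    have e4 : g.1 (t.reindex (Fin.succAbove 1)) =
      f.1 ⟨![ρ (t.1 0), σ (t.1 0)], hedge y _ _ hρ0 hσ0⟩ := rfl
    change -(∑ k : Fin 2, (-1 : ℤ) ^ (k : ℕ) * g.1 (t.reindex k.succAbove)) =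
      f.1 (t.map hρ) - f.1 (t.map hσ)
    rw [Fin.sum_univ_two, e1, e2, e3, e4, Fin.val_zero, Fin.val_one, pow_zero, pow_one]
    linarith

theorem transition_eq_refineMap {n : ℕ} (hn : n < 2) {ρ : 𝒱.ι → 𝒰.ι} (hρ : IsRefinement 𝒰 𝒱 ρ)
    (h : 𝒰 ≤ 𝒱) : transition n 𝒰 𝒱 h = refineMap hρ n :=
  refineMap_eq_of_lt_two _ _ hn

theorem refineMap_id (n : ℕ) (h : IsRefinement 𝒰 𝒰 id) (x : CoverCohomology 𝒰 n) :
    refineMap h n x = x := by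
  obtain ⟨f, rfl⟩ := Submodule.Quotient.mk_surjective _ x
  rfl

theorem refineMap_comp {𝒲 : OpenCover Y} (n : ℕ) {ρ : 𝒱.ι → 𝒰.ι} {σ : 𝒲.ι → 𝒱.ι}
    (hρ : IsRefinement 𝒰 𝒱 ρ) (hσ : IsRefinement 𝒱 𝒲 σ) (h : IsRefinement 𝒰 𝒲 (ρ ∘ σ))
    (x : CoverCohomology 𝒰 n) : refineMap hσ n (refineMap hρ n x) = refineMap h n x := by
  obtain ⟨f, rfl⟩ := Submodule.Quotient.mk_surjective _ x
  rfl

theorem transition_self {n : ℕ} (hn : n < 2) (h : 𝒰 ≤ 𝒰) (x : CoverCohomology 𝒰 n) :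
    transition n 𝒰 𝒰 h x = x := by
  have hid : IsRefinement 𝒰 𝒰 id := fun _ => le_rfl
  rw [transition_eq_refineMap hn hid, refineMap_id]

theorem transition_transition {n : ℕ} (hn : n < 2) {𝒲 : OpenCover Y} (h1 : 𝒰 ≤ 𝒱) (h2 : 𝒱 ≤ 𝒲)
    (h3 : 𝒰 ≤ 𝒲) (x : CoverCohomology 𝒰 n) :
    transition n 𝒱 𝒲 h2 (transition n 𝒰 𝒱 h1 x) = transition n 𝒰 𝒲 h3 x := by
  obtain ⟨ρ, hρ⟩ := id h1
  obtain ⟨σ, hσ⟩ := id h2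
  have hρσ : IsRefinement 𝒰 𝒲 (ρ ∘ σ) := fun k => (hσ k).trans (hρ (σ k))
  rw [transition_eq_refineMap hn hρ, transition_eq_refineMap hn hσ,
    transition_eq_refineMap hn hρσ, refineMap_comp n hρ hσ hρσ]

theorem directedSystem_transition {I : Type*} [Preorder I] (𝒰 : I → OpenCover Y)
    (h𝒰 : Monotone 𝒰) {n : ℕ} (hn : n < 2) :
    DirectedSystem (fun X => CoverCohomology (𝒰 X) n)
      (fun X X' h => transition n (𝒰 X) (𝒰 X') (h𝒰 h)) where
  map_self _ x := transition_self hn _ x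
  map_map _ _ _ _ _ x := transition_transition hn _ _ _ x

open Classical in
theorem toCohomology_transition {n : ℕ} (h : 𝒰 ≤ 𝒱) (x : CoverCohomology 𝒰 n) :
    toCohomology n 𝒱 (transition n 𝒰 𝒱 h x) = toCohomology n 𝒰 x :=
  Module.DirectLimit.of_f

open Classical in
theorem exists_toCohomology_eq {n : ℕ} (z : Cohomology Y n) :
    ∃ (𝒰 : OpenCover Y) (x : CoverCohomology 𝒰 n), toCohomology n 𝒰 x = z :=
  Module.DirectLimit.exists_of z

open Classical in
theorem exists_transition_eq_zero {n : ℕ} (hn : n < 2) {x : CoverCohomology 𝒰 n}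
    (hx : toCohomology n 𝒰 x = 0) : ∃ (𝒱 : OpenCover Y) (h : 𝒰 ≤ 𝒱), transition n 𝒰 𝒱 h x = 0 := by
  have : DirectedSystem (fun 𝒰 : OpenCover Y => CoverCohomology 𝒰 n)
      (fun 𝒰 𝒱 h => transition n 𝒰 𝒱 h) := directedSystem_transition id monotone_id hn
  exact Module.DirectLimit.of.zero_exact hx

section System

variable {I : Type u} [Preorder I] (𝒰 : I → OpenCover Y) (h𝒰 : Monotone 𝒰) (n : ℕ)

open Classical in
/-- The canonical map from the cohomology of a member of a family of covers to the direct limit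
over the family. -/
noncomputable def toSystemLimit (X : I) : CoverCohomology (𝒰 X) n →ₗ[ℤ] SystemLimit 𝒰 h𝒰 n :=
  Module.DirectLimit.of ℤ I (fun X => CoverCohomology (𝒰 X) n)
    (fun X X' h => transition n (𝒰 X) (𝒰 X') (h𝒰 h)) X

open Classical in
theorem toSystemLimit_transition {X X' : I} (h : X ≤ X') (x : CoverCohomology (𝒰 X) n) :
    toSystemLimit 𝒰 h𝒰 n X' (transition n (𝒰 X) (𝒰 X') (h𝒰 h) x) = toSystemLimit 𝒰 h𝒰 n X x :=
  Module.DirectLimit.of_f (f := fun X X' h => transition n (𝒰 X) (𝒰 X') (h𝒰 h)) (hij := h)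

open Classical in
theorem systemLimitToCohomology_toSystemLimit (X : I) (x : CoverCohomology (𝒰 X) n) :
    systemLimitToCohomology 𝒰 h𝒰 n (toSystemLimit 𝒰 h𝒰 n X x) = toCohomology n (𝒰 X) x :=
  Module.DirectLimit.lift_of (fun X => toCohomology n (𝒰 X)) _ x

open Classical in
theorem exists_toSystemLimit_eq [Nonempty I] [IsDirectedOrder I] (z : SystemLimit 𝒰 h𝒰 n) :
    ∃ X x, toSystemLimit 𝒰 h𝒰 n X x = z :=
  Module.DirectLimit.exists_of z

/-- A class and its images under transition are identified in the direct limit by construction. No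
functoriality of the transition maps is needed, so this works in every degree. -/
theorem surjective_systemLimitToCohomology (hcof : ∀ 𝒱 : OpenCover Y, ∃ X, 𝒱 ≤ 𝒰 X) :
    Function.Surjective (systemLimitToCohomology 𝒰 h𝒰 n) := by
  intro z
  obtain ⟨𝒱, x, rfl⟩ := exists_toCohomology_eq z
  obtain ⟨X, hX⟩ := hcof 𝒱
  refine ⟨toSystemLimit 𝒰 h𝒰 n X (transition n 𝒱 (𝒰 X) hX x), ?_⟩
  rw [systemLimitToCohomology_toSystemLimit, toCohomology_transition]

variable {n} [Nonempty I] [IsDirectedOrder I]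

theorem injective_systemLimitToCohomology (hcof : ∀ 𝒱 : OpenCover Y, ∃ X, 𝒱 ≤ 𝒰 X) (hn : n < 2) :
    Function.Injective (systemLimitToCohomology 𝒰 h𝒰 n) := by
  rw [injective_iff_map_eq_zero]
  intro z hz
  obtain ⟨X, x, rfl⟩ := exists_toSystemLimit_eq 𝒰 h𝒰 n z
  rw [systemLimitToCohomology_toSystemLimit] at hz
  obtain ⟨𝒱, h, hx⟩ := exists_transition_eq_zero hn hz
  obtain ⟨X', hX'⟩ := hcof 𝒱
  obtain ⟨Z, h1, h2⟩ := exists_ge_ge X X'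
  -- The transition from 𝒰 X to 𝒰 Z factors through 𝒱, where the class already vanishes.
  rw [← toSystemLimit_transition 𝒰 h𝒰 n h1, ← transition_transition hn h (hX'.trans (h𝒰 h2)), hx,
    map_zero, map_zero]

theorem subsingleton_systemLimit (h : ∀ X, Subsingleton (CoverCohomology (𝒰 X) n)) :
    Subsingleton (SystemLimit 𝒰 h𝒰 n) := by
  refine subsingleton_of_forall_eq 0 fun z => ?_
  obtain ⟨X, x, rfl⟩ := exists_toSystemLimit_eq 𝒰 h𝒰 n z
  rw [Subsingleton.elim x 0, map_zero]

end System

end Cech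

/-! ### Vanishing in degrees at least two, and the theorem -/

namespace LinePattern
open Cech

variable {α : Type u} {W : Set (FreeGroup α)} {X : FiniteSubtree α}

/-- A simplex of dimension at least 2 has three listed vertices, and since no three distinct members
meet, two of these coincide. An alternating cochain vanishes there, so the cochain group is already
zero. -/
theorem WhCover.subsingleton_coverCohomology (𝒰 : WhCover W X) {n : ℕ} (hn : 2 ≤ n) :
    Subsingleton (CoverCohomology 𝒰.cover n) := by
  refine Cech.subsingleton_coverCohomology fun f => ?_
  ext t
  obtain ⟨y, hy⟩ := t.2
  replace hy : ∀ i, y ∈ 𝒰.U (t.1 i) := fun i => Set.mem_iInter.1 hy i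
  let i : Fin 3 → Fin (n + 1) := Fin.castLE (by lia)
  have hi : Function.Injective i := Fin.castLE_injective _
  by_cases h01 : t.1 (i 0) = t.1 (i 1)
  · exact Cochain.apply_eq_zero f t (hi.ne (by decide)) h01
  by_cases h02 : t.1 (i 0) = t.1 (i 2)
  · exact Cochain.apply_eq_zero f t (hi.ne (by decide)) h02
  by_cases h12 : t.1 (i 1) = t.1 (i 2)
  · exact Cochain.apply_eq_zero f t (hi.ne (by decide)) h12
  · exact absurd ⟨⟨hy (i 0), hy (i 1)⟩, hy (i 2)⟩
      (Set.eq_empty_iff_forall_notMem.1 (𝒰.no_triple _ _ _ h01 h02 h12) y)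

theorem exists_le_of_monotone [Finite α] (hW : W.Finite) (𝒰 : ∀ X : FiniteSubtree α, WhCover W X)
    (𝒱 : OpenCover (DecompositionSpace W)) : ∃ X, 𝒱 ≤ (𝒰 X).cover := by
  obtain ⟨X, hX⟩ := exists_forall_whCover_refines hW 𝒱
  exact ⟨X, hX (𝒰 X)⟩

theorem subsingleton_cohomology [Finite α] (hW : W.Finite) {n : ℕ} (hn : 2 ≤ n) :
    Subsingleton (Cohomology (DecompositionSpace W) n) := by
  have := isDirectedOrder_finiteSubtree (α := α)
  have : Nonempty (FiniteSubtree α) := ⟨FiniteSubtree.ball 0⟩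
  obtain ⟨𝒰, h𝒰⟩ := exists_monotone_whCover hW
  have := subsingleton_systemLimit (fun X => (𝒰 X).cover) h𝒰
    fun X => (𝒰 X).subsingleton_coverCohomology hn
  exact (surjective_systemLimitToCohomology (fun X => (𝒰 X).cover) h𝒰 n
    (exists_le_of_monotone hW 𝒰)).subsingleton

end LinePattern

open Cech LinePattern in
theorem mainTheorem7 {α : Type u} [Finite α] (W : Set (FreeGroup α)) (hW : W.Finite) :
    -- Any two finite subtrees lie in a common one.
    IsDirectedOrder (FiniteSubtree α) ∧
    -- Associated covers exist for all finite subtrees, and can be chosen compatibly.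
    (∃ 𝒰 : ∀ X : FiniteSubtree α, WhCover W X, Monotone fun X => (𝒰 X).cover) ∧
    (∀ (X X' : FiniteSubtree α), X ≤ X' → ∀ 𝒰 : WhCover W X,
      ∃ 𝒰' : WhCover W X', 𝒰.cover ≤ 𝒰'.cover) ∧
    -- Associated covers are cofinal among all open covers.
    (∀ 𝒱 : OpenCover (DecompositionSpace W), ∃ (X : FiniteSubtree α) (𝒰 : WhCover W X),
      𝒱 ≤ 𝒰.cover) ∧
    -- The nerve of an associated cover is the Whitehead graph.
    (∀ X : FiniteSubtree α, X.1.Nonempty → ∀ (𝒰 : WhCover W X) (k : ℕ)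
      (t : Fin (k + 1) → WhVertex X), Meets 𝒰.cover t ↔
        ∃ a b, (a = b ∨ (whiteheadGraph W X).Adj a b) ∧ ∀ i, t i = a ∨ t i = b) ∧
    -- For every compatible choice, the groups of the covers form a directed system, with
    -- transition maps induced by arbitrary refinement functions, and the direct limit is the
    -- Čech cohomology of the decomposition space through the canonical maps.
    (∀ (𝒰 : ∀ X : FiniteSubtree α, WhCover W X) (h𝒰 : Monotone fun X => (𝒰 X).cover) (n : ℕ),
      (∀ (X X' : FiniteSubtree α) (h : X ≤ X') (ρ : WhVertex X' → WhVertex X)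
        (hρ : IsRefinement (𝒰 X).cover (𝒰 X').cover ρ),
        refineMap hρ n = transition n (𝒰 X).cover (𝒰 X').cover (h𝒰 h)) ∧
      DirectedSystem (fun X => CoverCohomology (𝒰 X).cover n)
        (fun X X' h => transition n (𝒰 X).cover (𝒰 X').cover (h𝒰 h)) ∧
      Function.Bijective (systemLimitToCohomology (fun X => (𝒰 X).cover) h𝒰 n)) ∧
    -- The cohomology is concentrated in degrees 0 and 1.
    (∀ n : ℕ, 2 ≤ n →
      (∀ (X : FiniteSubtree α) (𝒰 : WhCover W X), Subsingleton (CoverCohomology 𝒰.cover n)) ∧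
      Subsingleton (Cohomology (DecompositionSpace W) n)) := by
  have hdir := isDirectedOrder_finiteSubtree (α := α)
  have : Nonempty (FiniteSubtree α) := ⟨FiniteSubtree.ball 0⟩
  refine ⟨hdir, exists_monotone_whCover hW, fun X X' h 𝒰 => 𝒰.exists_refinement hW h,
    fun 𝒱 => ?_, fun X hX 𝒰 k t => 𝒰.meets_iff hX t, fun 𝒰 h𝒰 n => ?_, fun n hn =>
      ⟨fun X 𝒰 => 𝒰.subsingleton_coverCohomology hn, subsingleton_cohomology hW hn⟩⟩
  · obtain ⟨X, hX⟩ := exists_forall_whCover_refines hW 𝒱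
    obtain ⟨𝒰⟩ := nonempty_whCover hW X
    exact ⟨X, 𝒰, hX 𝒰⟩
  · have hcof := exists_le_of_monotone hW 𝒰
    rcases lt_or_ge n 2 with hn | hn
    · exact ⟨fun X X' h ρ hρ => (transition_eq_refineMap hn hρ (h𝒰 h)).symm,
        directedSystem_transition _ h𝒰 hn, injective_systemLimitToCohomology _ h𝒰 hcof hn,
        surjective_systemLimitToCohomology _ h𝒰 n hcof⟩
    -- In degrees at least 2 every group of the system is zero, so independence, functoriality and
    -- injectivity hold trivially.
    · have hsub := fun X => (𝒰 X).subsingleton_coverCohomology hn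
      have := subsingleton_systemLimit _ h𝒰 hsub
      exact ⟨fun X X' h ρ hρ => LinearMap.ext fun x => Subsingleton.elim _ _,
        ⟨fun _ _ => Subsingleton.elim _ _, fun _ _ _ _ _ _ => Subsingleton.elim _ _⟩,
        Function.injective_of_subsingleton _, surjective_systemLimitToCohomology _ h𝒰 n hcof⟩
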